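/- Let $R$ be a (unital, associative, not necessarily commutative) ring. Call a map $f\colon A\to B$ of simplicial sets an $H_*(-;R)$-equivalence if it induces isomorphisms $H_k(A;R)\to H_k(B;R)$ for all $k\ge 0$. For a simplicial set $A$ and a topological space $X$ let $\mathrm{Map}(A,X)$ be the space of continuous maps $|A|\to X$ from the geometric realization, with the compact-open topology. A topological space $X$ is called $H_*(-;R)$-local if for every $H_*(-;R)$-equivalence $f\colon A\to B$ the restriction map $f^*\colon \mathrm{Map}(B,X)\to\mathrm{Map}(A,X)$ is a weak homotopy equivalence, i.e. a bijection on path components and on $\pi_k$ for all $k\ge 1$ and all basepoints. Let $n\ge 0$, let $F_n$ be the free group on $n$ generators $x_1,\dots,x_n$, and let $\alpha\colon F_n\to F_n$ be a homomorphism, with induced map $\alpha_{ab}\colon \mathbb Z^n\to\mathbb Z^n$ on abelianizations. For a group $G$ identify $\mathrm{Hom}(F_n,G)$ with $G^n$ via $\varphi\mapsto(\varphi(x_1),\dots,\varphi(x_n))$, and write $\alpha^*\colon G^n\to G^n$ for the map of sets that corresponds to $\varphi\mapsto\varphi\circ\alpha$. Suppose that $R\otimes_{\mathbb Z}\alpha_{ab}\colon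 R\otimes_{\mathbb Z}\mathbb Z^n\to R\otimes_{\mathbb Z}\mathbb Z^n$ is an isomorphism. Then for every $H_*(-;R)$-local topological space $X$ and every basepoint $x\in X$, the map $$\alpha^*\colon \pi_1(X,x)^n\to\pi_1(X,x)^n$$ is a bijection. -/

import Mathlib

universe u v

namespace BousfieldHomology

open CategoryTheory

section WeakEquivalence

variable {Y Z : Type*} [TopologicalSpace Y] [TopologicalSpace Z]

/-- The map on path components induced by a continuous map. -/
def pi0Map (f : C(Y, Z)) : ZerothHomotopy Y → ZerothHomotopy Z :=
  Quotient.map' f fun _ _ h => h.map f.continuous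

/-- Postcomposition of an `N`-dimensional based loop with a continuous map. -/
def genLoopMap {N : Type*} (f : C(Y, Z)) (y : Y) (p : GenLoop N Y y) : GenLoop N Z (f y) :=
  ⟨f.comp p.1, fun t ht => congrArg f (p.2 t ht)⟩

/-- The map on homotopy groups at a basepoint induced by a continuous map. -/
def homotopyGroupMap (N : Type*) (f : C(Y, Z)) (y : Y) :
    HomotopyGroup N Y y → HomotopyGroup N Z (f y) :=
  Quotient.map (genLoopMap f y) fun _ _ h => Nonempty.map (fun H => H.compContinuousMap f) h

/-- A weak homotopy equivalence: a bijection on path components and on all homotopy groups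
of positive degree at all basepoints. -/
def IsWeakHomotopyEquiv (f : C(Y, Z)) : Prop :=
  Function.Bijective (pi0Map f) ∧
    ∀ (k : ℕ) (y : Y), Function.Bijective (homotopyGroupMap (Fin (k + 1)) f y)

end WeakEquivalence

section Local

/-- A map of simplicial sets is an `H_*(-;R)`-equivalence if it induces an isomorphism on
homology with coefficients in `R` in every degree. -/
def IsHomologyEquiv (R : Type v) [Ring R] {A B : SSet.{u}} (f : A ⟶ B) : Prop :=
  ∀ k : ℕ, IsIso (SSet.homologyMap f (ModuleCat.of.{max u v} R (ULift.{u} R)) k)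

/-- The mapping space `Map(A, X)` from a simplicial set `A` to a topological space `X`: the
continuous maps from the geometric realization of `A` to `X`, with the compact-open topology. -/
noncomputable abbrev MappingSpace (A : SSet.{u}) (X : Type u) [TopologicalSpace X] : Type u :=
  C(SSet.toTop.obj A, X)

/-- The restriction `f^* : Map(B, X) → Map(A, X)` along a map `f : A ⟶ B`. -/
noncomputable def restrict {A B : SSet.{u}} (f : A ⟶ B) (X : Type u) [TopologicalSpace X] :
    C(MappingSpace B X, MappingSpace A X) :=
  ContinuousMap.compRightContinuousMap X (SSet.toTop.map f).hom

/-- `X` is local with respect to the class of `H_*(-;R)`-equivalences. The sources `A` of the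
mapping spaces are modelled by simplicial sets, so that `Map(A, X)` has the correct (derived)
homotopy type for every space `X`. -/
def IsHomologyLocal (R : Type v) [Ring R] (X : Type u) [TopologicalSpace X] : Prop :=
  ∀ (A B : SSet.{u}) (f : A ⟶ B), IsHomologyEquiv R f → IsWeakHomotopyEquiv (restrict f X)

end Local

section FreeGroup

/-- The endomorphism `α_ab` of `ℤ^n = (F_n)_ab`, written additively, as a `ℤ`-linear map. -/
def abMap {n : ℕ} (α : FreeGroup (Fin n) →* FreeGroup (Fin n)) :
    Additive (Abelianization (FreeGroup (Fin n))) →ₗ[ℤ]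
      Additive (Abelianization (FreeGroup (Fin n))) :=
  (MonoidHom.toAdditive (Abelianization.map α)).toIntLinearMap

/-- The map `α^* : G^n → G^n` that corresponds to precomposition with `α` under the
identification `G^n ≃ Hom(F_n, G)` given by `FreeGroup.lift`. -/
def pullback {n : ℕ} (α : FreeGroup (Fin n) →* FreeGroup (Fin n)) (G : Type*) [Group G] :
    (Fin n → G) → (Fin n → G) :=
  fun g => FreeGroup.lift.symm ((FreeGroup.lift g).comp α)

end FreeGroup

end BousfieldHomology

/-! ### Simplicial sets with one vertex and prescribed edges and triangles -/

namespace BousfieldHomology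
open CategoryTheory Opposite

/-! Let `w i` be a word for `α (x i)`. Bijectivity of `α^*` on `G ^ n` says that for every tuple `s`
the system `w i (c) = s i` has exactly one solution `c`. Take a wedge of circles for the `s i`,
attach circles for the `c i`, and then 2-cells for the equations. Up to sign, the relative chain
complex over `R` is `R ⊗ α_ab` from degree 2 to degree 1, hence acyclic, so the inclusion of the
wedge is an `H_*(-;R)`-equivalence and restriction along it is a weak equivalence of mapping spaces
into `X`.

Such a weak equivalence gives unique solvability in `π₁` (`IsHomologyLocal.existsUnique`).
Surjectivity on `π₀` gives existence, after transport along the path traced by the basepoint. For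
uniqueness, injectivity on `π₀` only shows that two solutions are conjugate by some `p` that
commutes with all `s i`. This `p` is the basepoint trace of a loop of maps on the wedge, and
surjectivity on `π₁` lifts that loop to the whole complex. Hence `p` commutes with the entire
solution, and the two solutions agree (`homotopic_of_homotopic_inl`).

The 2-cells are kept triangular by adding an edge for every word, together with triangles that spell
it letter by letter (`wordTriangle`). These extra cells cancel in homology
(`triangleBoundary_wordTriangle_injective` and its surjective counterpart). The homology equivalence
is `isHomologyEquiv_inclusion`, which rests on the acyclicity criterion `exactAt_of_generators`. -/

/-- A generating cell. -/
inductive Cell (E T : Type u) (k : SimplexCategory) : Type u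
  | vertex : Cell E T k
  | edge (e : E) (s : k ⟶ SimplexCategory.mk 1) : Cell E T k
  | triangle (t : T) (s : k ⟶ SimplexCategory.mk 2) : Cell E T k

namespace Cell
variable {E T : Type u}

def map {k l : SimplexCategory} (θ : l ⟶ k) : Cell E T k → Cell E T l
  | vertex => vertex
  | edge e s => edge e (θ ≫ s)
  | triangle t s => triangle t (θ ≫ s)

/-- The value of a cell in a simplicial set, given the values of the generating simplices. -/
def eval {Z : SSet.{u}} (z₀ : Z.obj (op (.mk 0))) (z₁ : E → Z.obj (op (.mk 1)))
    (z₂ : T → Z.obj (op (.mk 2))) {k : SimplexCategory} : Cell E T k → Z.obj (op k)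
  | vertex => Z.map (SimplexCategory.isTerminalZero.from k).op z₀
  | edge e s => Z.map s.op (z₁ e)
  | triangle t s => Z.map s.op (z₂ t)

/-- Only generating identifications are listed; `Quot` closes them up. Maps out are then easy to
define, while distinctness of simplices must be detected by a map out, namely `labeling`. -/
inductive Rel (d : T → Fin 3 → E) (k : SimplexCategory) : Cell E T k → Cell E T k → Prop
  | face (t : T) (i : Fin 3) (s : k ⟶ SimplexCategory.mk 1) :
      Rel d k (triangle t (s ≫ SimplexCategory.δ i)) (edge (d t i) s)
  | endpoint (e : E) (i : Fin 2) (s : k ⟶ SimplexCategory.mk 0) :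
      Rel d k (edge e (s ≫ SimplexCategory.δ i)) vertex

lemma Rel.map {d : T → Fin 3 → E} {k l : SimplexCategory} (θ : l ⟶ k) {a b : Cell E T k}
    (h : Rel d k a b) : Rel d l (a.map θ) (b.map θ) := by
  cases h with
  | face t i s => simpa [Cell.map] using! Rel.face (d := d) t i (θ ≫ s)
  | endpoint e i s => simpa [Cell.map] using! Rel.endpoint (d := d) e i (θ ≫ s)

end Cell

open scoped Simplicial

variable {E T : Type u}

def triangleComplex (d : T → Fin 3 → E) : SSet.{u} where
  obj k := Quot (Cell.Rel d k.unop)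
  map θ := ↾(Quot.map (Cell.map θ.unop) fun _ _ h => h.map θ.unop)
  map_id k := by
    ext ⟨x⟩
    cases x <;> simp [Cell.map, Quot.map]
  map_comp θ θ' := by
    ext ⟨x⟩
    cases x <;> simp [Cell.map, Quot.map]

namespace triangleComplex
variable (d : T → Fin 3 → E)

def mk {k : SimplexCategory} (x : Cell E T k) : (triangleComplex d).obj (op k) := Quot.mk _ x

variable {d}
lemma map_mk {k l : SimplexCategory} (θ : l ⟶ k) (x : Cell E T k) :
    (triangleComplex d).map θ.op (mk d x) = mk d (x.map θ) := rfl

lemma mk_surjective {k : SimplexCategory} : Function.Surjective (mk d (k := k)) :=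
  Quot.mk_surjective

variable (d)
lemma mk_triangle_face {k : SimplexCategory} (t : T) (i : Fin 3) (s : k ⟶ ⦋1⦌) :
    mk d (.triangle t (s ≫ SimplexCategory.δ i)) = mk d (.edge (d t i) s) :=
  Quot.sound (.face t i s)

lemma mk_edge_endpoint {k : SimplexCategory} (e : E) (i : Fin 2) (s : k ⟶ ⦋0⦌) :
    mk d (.edge e (s ≫ SimplexCategory.δ i)) = mk d .vertex :=
  Quot.sound (.endpoint e i s)

def vertex : (triangleComplex d) _⦋0⦌ := mk d .vertex
def edge (e : E) : (triangleComplex d) _⦋1⦌ := mk d (.edge e (𝟙 _))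
def triangle (t : T) : (triangleComplex d) _⦋2⦌ := mk d (.triangle t (𝟙 _))

lemma mk_vertex (k : SimplexCategory) :
    mk d .vertex = (triangleComplex d).map (SimplexCategory.isTerminalZero.from k).op (vertex d) := rfl
lemma mk_edge {k : SimplexCategory} (e : E) (s : k ⟶ ⦋1⦌) :
    mk d (.edge e s) = (triangleComplex d).map s.op (edge d e) := by
  simp [edge, map_mk, Cell.map]
lemma mk_triangle {k : SimplexCategory} (t : T) (s : k ⟶ ⦋2⦌) :
    mk d (.triangle t s) = (triangleComplex d).map s.op (triangle d t) := by
  simp [triangle, map_mk, Cell.map]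

lemma δ_edge (e : E) (i : Fin 2) : (triangleComplex d).δ i (edge d e) = vertex d := by
  have := mk_edge_endpoint d (k := ⦋0⦌) e i (𝟙 _)
  rw [Category.id_comp, mk_edge] at this
  exact this

lemma δ_triangle (t : T) (i : Fin 3) :
    (triangleComplex d).δ i (triangle d t) = edge d (d t i) := by
  have := mk_triangle_face d (k := ⦋1⦌) t i (𝟙 _)
  rw [Category.id_comp, mk_triangle] at this
  exact this

variable {d}

def desc {Z : SSet.{u}} (z₀ : Z _⦋0⦌) (z₁ : E → Z _⦋1⦌) (z₂ : T → Z _⦋2⦌)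
    (h₁ : ∀ e i, Z.δ i (z₁ e) = z₀) (h₂ : ∀ t i, Z.δ i (z₂ t) = z₁ (d t i)) :
    triangleComplex d ⟶ Z where
  app k := ↾(Quot.lift (Cell.eval z₀ z₁ z₂) (by
    rintro _ _ (⟨t, i, s⟩ | ⟨e, i, s⟩) <;> dsimp only [Cell.eval]
    · simp only [op_comp, Functor.map_comp_apply]
      exact congrArg _ (h₂ t i)
    · simp only [op_comp, Functor.map_comp_apply]
      rw [SimplexCategory.isTerminalZero.hom_ext (SimplexCategory.isTerminalZero.from k.unop) s]
      exact congrArg _ (h₁ e i)))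
  naturality k l θ := by
    ext ⟨x⟩
    cases x with
    | vertex =>
      change Z.map _ z₀ = Z.map θ (Z.map _ z₀)
      rw [← Functor.map_comp_apply]; rfl
    | edge e s => exact Functor.map_comp_apply Z s.op θ _
    | triangle t s => exact Functor.map_comp_apply Z s.op θ _

section
variable {Z : SSet.{u}} (z₀ : Z _⦋0⦌) (z₁ : E → Z _⦋1⦌) (z₂ : T → Z _⦋2⦌)
    (h₁ : ∀ e i, Z.δ i (z₁ e) = z₀) (h₂ : ∀ t i, Z.δ i (z₂ t) = z₁ (d t i))

@[simp] lemma desc_edge (e : E) : (desc z₀ z₁ z₂ h₁ h₂).app _ (edge d e) = z₁ e :=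
  Functor.map_id_apply Z _ _
@[simp] lemma desc_vertex : (desc z₀ z₁ z₂ h₁ h₂).app _ (vertex d) = z₀ := by
  have : SimplexCategory.isTerminalZero.from ⦋0⦌ = 𝟙 _ :=
    SimplexCategory.isTerminalZero.hom_ext _ _
  change Z.map (SimplexCategory.isTerminalZero.from ⦋0⦌).op z₀ = _
  rw [this]
  exact Functor.map_id_apply Z _ _
end

lemma hom_ext {Z : SSet.{u}} {f g : triangleComplex d ⟶ Z}
    (h₀ : f.app _ (vertex d) = g.app _ (vertex d))
    (h₁ : ∀ e, f.app _ (edge d e) = g.app _ (edge d e))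
    (h₂ : ∀ t, f.app _ (triangle d t) = g.app _ (triangle d t)) : f = g := by
  refine NatTrans.ext (funext fun k => ConcreteCategory.hom_ext _ _ fun x => ?_)
  obtain ⟨k⟩ := k
  obtain ⟨x, rfl⟩ := mk_surjective x
  cases x with
  | vertex => rw [mk_vertex, NatTrans.naturality_apply, NatTrans.naturality_apply, h₀]
  | edge e s => rw [mk_edge, NatTrans.naturality_apply, NatTrans.naturality_apply, h₁]
  | triangle t s => rw [mk_triangle, NatTrans.naturality_apply, NatTrans.naturality_apply, h₂]

end triangleComplex
end BousfieldHomology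

/-! ### Wedges of circles and nondegenerate simplices -/

namespace BousfieldHomology
open CategoryTheory Opposite
open scoped Simplicial

/-- The simplicial set whose simplices are labellings of ordered pairs of vertices. -/
def edgeLabels (E : Type u) : SSet.{u} where
  obj k := Fin (k.unop.len + 1) → Fin (k.unop.len + 1) → Option E
  map θ := ↾(fun f i j => f (θ.unop.toOrderHom i) (θ.unop.toOrderHom j))

namespace triangleComplex
variable {E T S : Type u} (d : T → Fin 3 → E)

/-- A simplex `s` of the edge `e` carries the label `e` exactly at the pairs `(a, b)` with `s a = 0`
and `s b = 1`. If `s` is nonconstant, these labels recover both `e` and `s`. -/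
def labeling : triangleComplex d ⟶ edgeLabels E :=
  desc (Z := edgeLabels E) (fun _ _ => none)
    (fun e i j => if i = (0 : Fin 2) ∧ j = (1 : Fin 2) then some e else none)
    (fun t i j => if i = (0 : Fin 3) ∧ j = (1 : Fin 3) then some (d t 2) else
      if i = (1 : Fin 3) ∧ j = (2 : Fin 3) then some (d t 0) else
      if i = (0 : Fin 3) ∧ j = (2 : Fin 3) then some (d t 1) else none)
    (by
      intro e i
      funext (a : Fin 1) (b : Fin 1)
      refine if_neg ?_
      rintro ⟨h₁, h₂⟩
      rw [Subsingleton.elim b a] at h₂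
      exact absurd (h₁.symm.trans h₂) (by decide))
    (by
      intro t i
      funext (a : Fin 2) (b : Fin 2)
      fin_cases i <;> fin_cases a <;> fin_cases b <;> rfl)

lemma labeling_mk_edge {k : SimplexCategory} (e : E) (s : k ⟶ ⦋1⦌) (a b : Fin (k.len + 1)) :
    (show Fin (k.len + 1) → Fin (k.len + 1) → Option E from
      (labeling d).app (op k) (mk d (.edge e s))) a b =
      if s.toOrderHom a = 0 ∧ s.toOrderHom b = 1 then some e else none := rfl

/-- The wedge of circles on a family of edges. -/
abbrev _root_.BousfieldHomology.wedge (S : Type u) : SSet.{u} :=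
  triangleComplex (E := S) (T := PEmpty) PEmpty.elim

def inclusion (i : S → E) : wedge S ⟶ triangleComplex d :=
  desc (vertex d) (fun s => edge d (i s)) PEmpty.elim (fun _ _ => δ_edge _ _ _) (fun t => t.elim)

lemma inclusion_mk_edge (i : S → E) {k : SimplexCategory} (e : S) (s : k ⟶ ⦋1⦌) :
    (inclusion d i).app (op k) (mk _ (.edge e s)) = mk d (.edge (i e) s) := by
  rw [mk_edge d]; rfl

lemma inclusion_mk_vertex (i : S → E) {k : SimplexCategory} :
    (inclusion d i).app (op k) (mk _ .vertex) = mk d .vertex := rfl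

@[simp] lemma inclusion_edge (i : S → E) (e : S) :
    (inclusion d i).app _ (edge _ e) = edge d (i e) := desc_edge ..
@[simp] lemma inclusion_vertex (i : S → E) :
    (inclusion d i).app _ (vertex _) = vertex d := desc_vertex ..

lemma _root_.BousfieldHomology.fin_two_cases (a : Fin 2) : a = 0 ∨ a = 1 := by
  fin_cases a <;> simp

lemma _root_.BousfieldHomology.eq_const_or {k : SimplexCategory} (s : k ⟶ ⦋1⦌) :
    (∃ i, s = SimplexCategory.isTerminalZero.from k ≫ SimplexCategory.δ (i : Fin 2)) ∨
      ∃ a b, s.toOrderHom a = 0 ∧ s.toOrderHom b = 1 := by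
  by_cases h0 : ∃ a, s.toOrderHom a = 0
  · by_cases h1 : ∃ b, s.toOrderHom b = 1
    · obtain ⟨a, ha⟩ := h0
      obtain ⟨b, hb⟩ := h1
      exact .inr ⟨a, b, ha, hb⟩
    · refine .inl ⟨1, ?_⟩
      ext a : 3
      have : s.toOrderHom a ≠ 1 := fun h => h1 ⟨a, h⟩
      exact (fin_two_cases _).resolve_right this
  · refine .inl ⟨0, ?_⟩
    ext a : 3
    have : s.toOrderHom a ≠ 0 := fun h => h0 ⟨a, h⟩
    exact (fin_two_cases _).resolve_left this

/-- Every simplex of a wedge of circles is the vertex or a nonconstant simplex of a circle. -/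
lemma wedge_cases {k : SimplexCategory} (x : (wedge S).obj (op k)) :
    x = mk _ .vertex ∨ ∃ e s a b, x = mk _ (.edge e s) ∧ s.toOrderHom a = 0 ∧
      s.toOrderHom b = 1 := by
  obtain ⟨x, rfl⟩ := mk_surjective x
  cases x with
  | vertex => exact .inl rfl
  | edge e s =>
    obtain ⟨i, rfl⟩ | ⟨a, b, ha, hb⟩ := eq_const_or s
    · exact .inl (mk_edge_endpoint ..)
    · exact .inr ⟨e, s, a, b, rfl, ha, hb⟩
  | triangle t => exact t.elim

lemma inclusion_injective {i : S → E} (hi : Function.Injective i) (k : SimplexCategory) :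
    Function.Injective ((inclusion d i).app (op k)) := by
  intro x y h
  have key := congrArg (fun z => (show Fin (k.len + 1) → Fin (k.len + 1) → Option E from
      (labeling d).app (op k) z)) h
  have key' := fun a b => congrFun (congrFun key a) b
  obtain rfl | ⟨e, s, a, b, rfl, ha, hb⟩ := wedge_cases x <;>
  obtain rfl | ⟨e', s', a', b', rfl, ha', hb'⟩ := wedge_cases y
  · rfl
  · have := key' a' b'
    rw [inclusion_mk_edge] at this
    have h2 := (labeling_mk_edge d (i e') s' a' b').symm.trans this.symm
    rw [if_pos ⟨ha', hb'⟩] at h2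
    cases h2
  · have := key' a b
    rw [inclusion_mk_edge] at this
    have h2 := (labeling_mk_edge d (i e) s a b).symm.trans this
    rw [if_pos ⟨ha, hb⟩] at h2
    cases h2
  · rw [inclusion_mk_edge, inclusion_mk_edge] at key'
    replace key' : ∀ p q, (if s.toOrderHom p = 0 ∧ s.toOrderHom q = 1 then some (i e) else none) =
      (if s'.toOrderHom p = 0 ∧ s'.toOrderHom q = 1 then some (i e') else none) := key'
    have h1 := key' a b
    rw [if_pos ⟨ha, hb⟩] at h1
    split_ifs at h1 with h2
    obtain rfl : e = e' := hi (Option.some_injective _ h1)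
    congr 2
    ext p : 3
    -- Pairing `p` with the fixed vertex `b` over `1` tests whether `p` lies over `0`.
    have h3 := key' p b
    by_cases hp : s.toOrderHom p = 0
    · rw [if_pos ⟨hp, hb⟩] at h3
      split_ifs at h3 with h4
      exact hp.trans h4.1.symm
    · rw [if_neg (fun h => hp h.1)] at h3
      split_ifs at h3 with h4
      have hp' : s'.toOrderHom p ≠ 0 := fun h => h4 ⟨h, h2.2⟩
      exact ((fin_two_cases _).resolve_left hp).trans
        ((fin_two_cases _).resolve_left hp').symm

lemma mk_cases {k : SimplexCategory} (x : (triangleComplex d).obj (op k)) :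
    x = mk d .vertex ∨ (∃ e s, x = mk d (.edge e s)) ∨ ∃ t s, x = mk d (.triangle t s) := by
  obtain ⟨x, rfl⟩ := mk_surjective x
  cases x with
  | vertex => exact .inl rfl
  | edge e s => exact .inr (.inl ⟨e, s, rfl⟩)
  | triangle t s => exact .inr (.inr ⟨t, s, rfl⟩)

end triangleComplex

lemma hom_mk_cases {k m : ℕ} (s : ⦋k⦌ ⟶ ⦋m + 1⦌) :
    ¬ Mono s ∨ (∃ i s', s = s' ≫ SimplexCategory.δ (n := m) i) ∨
      ∃ h : k = m + 1, s = eqToHom (by rw [h]) := by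
  by_cases hs : Mono s
  · by_cases hs' : Function.Surjective s.toOrderHom
    · have h1 := SimplexCategory.len_le_of_mono s
      have : Epi s := SimplexCategory.epi_iff_surjective.2 hs'
      have h2 := SimplexCategory.len_le_of_epi s
      obtain rfl : k = m + 1 := le_antisymm h1 h2
      exact .inr (.inr ⟨rfl, SimplexCategory.eq_id_of_mono s⟩)
    · exact .inr (.inl (SimplexCategory.eq_comp_δ_of_not_surjective s hs'))
  · exact .inl hs

namespace triangleComplex
variable {E T S : Type u} (d : T → Fin 3 → E)

/-- A simplex of `triangleComplex d` is degenerate, the vertex, an edge or a triangle. -/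
lemma simplex_cases {k : ℕ} (x : (triangleComplex d) _⦋k⦌) :
    (∃ (m : SimplexCategory) (s : ⦋k⦌ ⟶ m) (y : (triangleComplex d).obj (op m)), ¬ Mono s ∧
      x = (triangleComplex d).map s.op y) ∨ x = mk d .vertex ∨
    (∃ (h : k = 1) (e : E), x = mk d (.edge e (eqToHom (by rw [h])))) ∨
    (∃ (h : k = 2) (t : T), x = mk d (.triangle t (eqToHom (by rw [h])))) := by
  by_cases hedge : ∃ e s, x = mk d (.edge e s)
  · obtain ⟨e, s, hx⟩ := hedge
    obtain hs | ⟨i, s, rfl⟩ | ⟨h, hs⟩ := hom_mk_cases s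
    · exact .inl ⟨_, s, edge d e, hs, hx.trans (mk_edge d e s)⟩
    · exact .inr (.inl (hx.trans (mk_edge_endpoint ..)))
    · exact .inr (.inr (.inl ⟨h, e, hs ▸ hx⟩))
  obtain hx | hx | ⟨t, s, hx⟩ := mk_cases d x
  · exact .inr (.inl hx)
  · exact absurd hx hedge
  · obtain hs | ⟨i, s, rfl⟩ | ⟨h, hs⟩ := hom_mk_cases s
    · exact .inl ⟨_, s, triangle d t, hs, hx.trans (mk_triangle d t s)⟩
    · exact absurd ⟨_, _, hx.trans (mk_triangle_face ..)⟩ hedge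
    · exact .inr (.inr (.inr ⟨h, t, hs ▸ hx⟩))
end triangleComplex
end BousfieldHomology

/-! ### An acyclicity criterion for simplicial modules -/

namespace BousfieldHomology
open CategoryTheory Opposite Limits
open scoped Simplicial
open AlgebraicTopology.DoldKan

/-- A monomorphism of complexes with acyclic cokernel is a quasi-isomorphism. -/
lemma isIso_homologyMap_of_acyclic {C : Type*} [Category* C] [Abelian C]
    {S : ShortComplex (ChainComplex C ℕ)} (hS : S.ShortExact) (h : ∀ n, S.X₃.ExactAt n) (n : ℕ) :
    IsIso (HomologicalComplex.homologyMap S.f n) := by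
  have hz : ∀ m, IsZero (S.X₃.homology m) := fun m => (h m).isZero_homology
  have : Epi (HomologicalComplex.homologyMap S.f n) :=
    (hS.homology_exact₂ n).epi_f ((hz n).eq_of_tgt _ _)
  have : Mono (HomologicalComplex.homologyMap S.f n) :=
    (hS.homology_exact₁ (n + 1) n rfl).mono_g ((hz (n + 1)).eq_of_src _ _)
  exact isIso_of_mono_of_epi _

section acyclic
variable {R : Type v} [Ring R]

lemma exists_sub_eq_d_of_homotopy {K : ChainComplex (ModuleCat.{max u v} R) ℕ} {f : K ⟶ K}
    (h : Homotopy f (𝟙 K)) (k : ℕ) (z : K.X (k + 1)) (hz : (K.d (k + 1) k).hom z = 0) :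
    ∃ w, (f.f (k + 1)).hom z = (K.d (k + 2) (k + 1)).hom w + z := by
  refine ⟨(h.hom (k + 1) (k + 2)).hom z, ?_⟩
  have := congrArg (fun g => g.hom z) (h.comm (k + 1))
  rw [Homotopy.dNext_succ_chainComplex, Homotopy.prevD_chainComplex] at this
  simpa [hz] using this

lemma exactAt_succ_iff (K : ChainComplex (ModuleCat.{max u v} R) ℕ) (k : ℕ) :
    K.ExactAt (k + 1) ↔ ∀ z, (K.d (k + 1) k).hom z = 0 → ∃ w, (K.d (k + 2) (k + 1)).hom w = z := by
  rw [K.exactAt_iff' (k + 2) (k + 1) k (by simp) (by simp), ShortComplex.moduleCat_exact_iff]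
  rfl

lemma exists_preimage_of_homologous {A B : Type*} [AddCommGroup A] [AddCommGroup B] [Module R A]
    [Module R B] (d : A →ₗ[R] B) {w w' t : A} {p z y : B} (hw : p = d w + z) (hw' : p = d w' + y)
    (ht : d t = y) : ∃ x, d x = z :=
  ⟨w' + t - w, by rw [map_sub, map_add, ht, ← hw', hw, add_sub_cancel_left]⟩

variable {N T : Type u} (M : SimplicialObject (ModuleCat.{max u v} R))

/-- A simplicial module whose normalized complex is an isomorphism concentrated in degrees
`2` and `1` is acyclic. -/
lemma exactAt_of_generators (e : (N →₀ R) →ₗ[R] M _⦋1⦌) (τ : (T →₀ R) →ₗ[R] M _⦋2⦌)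
    (L : (T →₀ R) →ₗ[R] (N →₀ R)) (hL : Function.Bijective L)
    (φ : M _⦋1⦌ →ₗ[R] (N →₀ R)) (hφ : ∀ a, φ (e a) = a)
    (hP : ∀ k, k ≠ 1 → k ≠ 2 →
      (PInfty : (AlgebraicTopology.alternatingFaceMapComplex _).obj M ⟶ _).f k = 0)
    (h1 : ∀ z : M _⦋1⦌, ∃ a, (PInfty (X := M).f 1).hom z = (PInfty (X := M).f 1).hom (e a))
    (h2 : ∀ z : M _⦋2⦌, ∃ a, (PInfty (X := M).f 2).hom z = (PInfty (X := M).f 2).hom (τ a))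
    (hd : ∀ a, (((AlgebraicTopology.alternatingFaceMapComplex _).obj M).d 2 1).hom (τ a) = e (L a))
    (n : ℕ) : ((AlgebraicTopology.alternatingFaceMapComplex _).obj M).ExactAt n := by
  set K := (AlgebraicTopology.alternatingFaceMapComplex _).obj M with hK
  -- `PInfty` is the identity in degree 0, so its vanishing there kills the whole module.
  have hzero : 𝟙 (M _⦋0⦌) = 0 := PInfty_f_0.symm.trans (hP 0 (by decide) (by decide))
  have hzero' : IsZero (M _⦋0⦌) := (IsZero.iff_id_eq_zero _).2 hzero
  -- Every cycle is homologous to its normalization, so only normalized chains matter.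
  have hom := fun k => exists_sub_eq_d_of_homotopy (homotopyPInftyToId M) k
  obtain _ | _ | _ | n := n
  · exact HomologicalComplex.ExactAt.of_isZero hzero'
  · refine (exactAt_succ_iff K 0).2 fun z hz => ?_
    obtain ⟨a, ha⟩ := h1 z
    obtain ⟨b, rfl⟩ := hL.2 a
    have hz' : ∀ y : K.X 1, (K.d 1 0).hom y = 0 := fun y => by
      rw [hzero'.eq_of_tgt (K.d 1 0) 0]; rfl
    obtain ⟨w, hw⟩ := hom 0 z (hz' _)
    obtain ⟨w', hw'⟩ := hom 0 (e (L b)) (hz' _)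
    exact exists_preimage_of_homologous (K.d 2 1).hom hw (ha.trans hw') (hd b)
  · refine (exactAt_succ_iff K 1).2 fun z hz => ?_
    obtain ⟨a, ha⟩ := h2 z
    obtain ⟨w, hw⟩ := hom 1 z hz
    have hcomm : ∀ y : K.X 2, (K.d 2 1).hom ((PInfty (X := M).f 2).hom y) =
        (PInfty (X := M).f 1).hom ((K.d 2 1).hom y) := fun y =>
      congrArg (fun g => g.hom y) ((PInfty (X := M)).comm 2 1)
    -- In degree 1 degeneracies come from `M _⦋0⦌ = 0`, so `φ` vanishes on the degenerate part and
    -- still detects `e b` after normalization.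
    have hPe : ∀ b, φ ((PInfty (X := M).f 1).hom (e b)) = b := fun b => by
      have hQ : QInfty.f 1 ≫ ModuleCat.ofHom φ = 0 := by
        rw [← degeneraciesVanish_iff_QInfty_f_comp]
        intro i
        rw [hzero'.eq_of_src (M.σ i) 0, zero_comp]
      have h3 := congrArg (fun g => g ≫ ModuleCat.ofHom φ) (PInfty_f_add_QInfty_f (X := M) 1)
      rw [Preadditive.add_comp, hQ, add_zero, Category.id_comp] at h3
      exact (congrArg (fun g => g.hom (e b)) h3).trans (hφ b)
    have ha0 : a = 0 := by
      have h3 := hcomm z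
      rw [hz, ha, hcomm, hd, map_zero] at h3
      have h4 := hPe (L a)
      rw [h3, map_zero] at h4
      exact (map_eq_zero_iff L hL.1).1 h4.symm
    rw [ha, ha0, map_zero, map_zero] at hw
    exact ⟨-w, by rw [map_neg]; exact (eq_neg_of_add_eq_zero_right hw.symm).symm⟩
  · refine (exactAt_succ_iff K (n + 2)).2 fun z hz => ?_
    obtain ⟨w, hw⟩ := hom (n + 2) z hz
    rw [hP _ (by omega) (by omega)] at hw
    exact ⟨-w, by rw [map_neg]; exact (eq_neg_of_add_eq_zero_right hw.symm).symm⟩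
end acyclic
end BousfieldHomology

/-! ### Free and relative simplicial chains -/

namespace BousfieldHomology
open CategoryTheory Opposite Limits
open scoped Simplicial
open AlgebraicTopology.DoldKan

/-- A retraction sends each summand in the image back to its source and kills the others. -/
lemma mono_sigmaConst_map {C : Type*} [Category* C] [HasCoproducts.{u} C] [HasZeroMorphisms C]
    (M : C) {I J : Type u} (f : I ⟶ J) (hf : Function.Injective f) :
    Mono ((sigmaConst.obj M).map f) := by
  classical
  refine SplitMono.mono ⟨Sigma.desc fun j =>
    if h : ∃ i, f i = j then Sigma.ι (fun _ : I => M) h.choose else 0, ?_⟩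
  refine Sigma.hom_ext _ _ fun i => ?_
  have h : ∃ i', f i' = f i := ⟨i, rfl⟩
  have h' : h.choose = i := hf h.choose_spec
  simp [h']

lemma ι_sigmaConst_map {C : Type*} [Category* C] [HasCoproducts.{u} C]
    (M : C) {I J : Type u} (f : I ⟶ J) (i : I) :
    Sigma.ι (fun _ : I => M) i ≫ (sigmaConst.obj M).map f = Sigma.ι (fun _ : J => M) (f i) := by
  simp

section
variable (R : Type v) [Ring R]

/-- The free simplicial `R`-module on a simplicial set. -/
noncomputable def freeModule : SSet.{u} ⥤ SimplicialObject (ModuleCat.{max u v} R) :=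
  (SimplicialObject.whiskering _ _).obj
    (sigmaConst.obj (ModuleCat.of.{max u v} R (ULift.{u} R)))

variable {R}

/-- The inclusion of the summand of a simplex in the free simplicial module. -/
noncomputable def freeι {B : SSet.{u}} {k : SimplexCategoryᵒᵖ} (x : B.obj k) :
    ModuleCat.of.{max u v} R (ULift.{u} R) ⟶ ((freeModule R).obj B).obj k :=
  Sigma.ι (fun _ : B.obj k => ModuleCat.of.{max u v} R (ULift.{u} R)) x

lemma freeι_map {B : SSet.{u}} {k l : SimplexCategoryᵒᵖ} (θ : k ⟶ l) (x : B.obj k) :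
    freeι (R := R) x ≫ ((freeModule R).obj B).map θ = freeι (B.map θ x) :=
  ι_sigmaConst_map _ (B.map θ) x

lemma freeι_app {A B : SSet.{u}} (f : A ⟶ B) {k : SimplexCategoryᵒᵖ} (a : A.obj k) :
    freeι (R := R) a ≫ ((freeModule R).map f).app k = freeι (f.app k a) :=
  ι_sigmaConst_map _ (f.app k) a

lemma freeι_hom_ext {B : SSet.{u}} {k : SimplexCategoryᵒᵖ} {V : ModuleCat.{max u v} R}
    {g h : ((freeModule R).obj B).obj k ⟶ V} (H : ∀ x, freeι x ≫ g = freeι x ≫ h) : g = h :=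
  Sigma.hom_ext _ _ H

lemma exists_freeι_desc {B : SSet.{u}} {k : SimplexCategoryᵒᵖ} {V : ModuleCat.{max u v} R}
    (g : B.obj k → (ModuleCat.of.{max u v} R (ULift.{u} R) ⟶ V)) :
    ∃ φ : ((freeModule R).obj B).obj k ⟶ V, ∀ x, freeι x ≫ φ = g x :=
  ⟨Sigma.desc g, fun x => Sigma.ι_desc g x⟩

/-- The relative simplicial `R`-chains of a map of simplicial sets. -/
noncomputable abbrev relativeModule {A B : SSet.{u}} (f : A ⟶ B) :
    ShortComplex (SimplicialObject (ModuleCat.{max u v} R)) :=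
  ShortComplex.mk ((freeModule R).map f) (cokernel.π ((freeModule R).map f))
    (cokernel.condition _)

lemma relativeModule_shortExact {A B : SSet.{u}} (f : A ⟶ B)
    (hf : ∀ k, Function.Injective (f.app k)) : (relativeModule (R := R) f).ShortExact where
  exact := ShortComplex.exact_cokernel _
  mono_f := by
    have : ∀ k, Mono (((freeModule R).map f).app k) := fun k => by
      change Mono ((sigmaConst.obj (ModuleCat.of.{max u v} R (ULift.{u} R))).map (f.app k))
      exact mono_sigmaConst_map _ _ (hf k)
    change Mono ((freeModule R).map f)
    exact NatTrans.mono_of_mono_app _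
  epi_g := by dsimp [relativeModule]; infer_instance

lemma relativeModule_app_shortExact {A B : SSet.{u}} (f : A ⟶ B)
    (hf : ∀ k, Function.Injective (f.app k)) (k : SimplexCategoryᵒᵖ) :
    ((relativeModule (R := R) f).map ((evaluation _ _).obj k)).ShortExact :=
  (relativeModule_shortExact f hf).map_of_exact _

lemma isHomologyEquiv_of_exactAt {A B : SSet.{u}} (f : A ⟶ B)
    (hf : ∀ k, Function.Injective (f.app k))
    (h : ∀ n, ((AlgebraicTopology.alternatingFaceMapComplex _).obj
      (relativeModule (R := R) f).X₃).ExactAt n) : IsHomologyEquiv R f := by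
  intro n
  refine isIso_homologyMap_of_acyclic
    (S := (relativeModule (R := R) f).map (AlgebraicTopology.alternatingFaceMapComplex _)) ?_ h n
  exact HomologicalComplex.shortExact_of_degreewise_shortExact _
    fun k => relativeModule_app_shortExact f hf (op ⦋k⦌)

end
end BousfieldHomology

/-! ### Generators of the relative chains -/

namespace BousfieldHomology
open CategoryTheory Opposite Limits
open scoped Simplicial
open AlgebraicTopology.DoldKan

section relative
variable {R : Type v} [Ring R] {A B : SSet.{u}} (f : A ⟶ B)

/-- The inclusion of the summand of a simplex in the relative chains. -/
noncomputable def relι {k : SimplexCategoryᵒᵖ} (x : B.obj k) :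
    ModuleCat.of.{max u v} R (ULift.{u} R) ⟶ (relativeModule (R := R) f).X₃.obj k :=
  freeι x ≫ (relativeModule (R := R) f).g.app k

lemma relι_map {k l : SimplexCategoryᵒᵖ} (θ : k ⟶ l) (x : B.obj k) :
    relι (R := R) f x ≫ (relativeModule (R := R) f).X₃.map θ = relι f (B.map θ x) := by
  rw [relι, relι, ← freeι_map, Category.assoc, Category.assoc, NatTrans.naturality]

lemma relι_app {k : SimplexCategoryᵒᵖ} (a : A.obj k) : relι (R := R) f (f.app k a) = 0 := by
  rw [relι, ← freeι_app, Category.assoc, ← NatTrans.comp_app, (relativeModule (R := R) f).zero]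
  exact comp_zero

lemma relι_hom_ext {k : SimplexCategoryᵒᵖ} {V : ModuleCat.{max u v} R}
    {g h : (relativeModule (R := R) f).X₃.obj k ⟶ V} (H : ∀ x, relι f x ≫ g = relι f x ≫ h) :
    g = h := by
  have : Epi (relativeModule (R := R) f).g := by dsimp [relativeModule]; infer_instance
  rw [← cancel_epi ((relativeModule (R := R) f).g.app k)]
  refine freeι_hom_ext fun x => ?_
  simpa only [relι, Category.assoc] using H x

/-- Evaluation is exact, so the cokernel property can be used in a single simplicial degree. -/
lemma exists_relι_desc (hf : ∀ k, Function.Injective (f.app k)) {k : SimplexCategoryᵒᵖ}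
    {V : ModuleCat.{max u v} R} (g : B.obj k → (ModuleCat.of.{max u v} R (ULift.{u} R) ⟶ V))
    (hg : ∀ a, g (f.app k a) = 0) :
    ∃ φ : (relativeModule (R := R) f).X₃.obj k ⟶ V, ∀ x, relι f x ≫ φ = g x := by
  have hS := relativeModule_app_shortExact (R := R) f hf k
  have := hS.epi_g
  obtain ⟨ψ, hψ⟩ := exists_freeι_desc (R := R) (B := B) g
  have hψ' : ((freeModule R).map f).app k ≫ ψ = 0 := freeι_hom_ext fun a => by
    rw [← Category.assoc, freeι_app, hψ, hg, comp_zero]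
  refine ⟨hS.exact.gIsCokernel.desc (CokernelCofork.ofπ ψ hψ'), fun x => ?_⟩
  have h := hS.exact.gIsCokernel.fac (CokernelCofork.ofπ ψ hψ') WalkingParallelPair.one
  have h' := congrArg (fun q => freeι x ≫ q) h
  refine Eq.trans ?_ (h'.trans (hψ x))
  exact Category.assoc _ _ _

/-- The class of a simplex in the relative chains. -/
noncomputable def relGen {k : SimplexCategoryᵒᵖ} (x : B.obj k) :
    (relativeModule (R := R) f).X₃.obj k := (relι f x).hom ⟨1⟩

lemma map_relGen {k l : SimplexCategoryᵒᵖ} (θ : k ⟶ l) (x : B.obj k) :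
    ((relativeModule (R := R) f).X₃.map θ).hom (relGen f x) = relGen f (B.map θ x) :=
  congrArg (fun g => ModuleCat.Hom.hom g (ULift.up (1 : R))) (relι_map f θ x)

lemma relGen_app {k : SimplexCategoryᵒᵖ} (a : A.obj k) : relGen (R := R) f (f.app k a) = 0 :=
  congrArg (fun g => ModuleCat.Hom.hom g (ULift.up (1 : R))) (relι_app f a)

lemma relι_apply {k : SimplexCategoryᵒᵖ} (x : B.obj k) (r : ULift.{u} R) :
    (relι f x).hom r = r.down • relGen f x := by
  rw [relGen, ← map_smul]
  congr 1
  exact ULift.ext _ _ (mul_one _).symm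

lemma hom_ext_relGen {k : SimplexCategoryᵒᵖ} {V : ModuleCat.{max u v} R}
    {g h : (relativeModule (R := R) f).X₃.obj k ⟶ V}
    (H : ∀ x, g.hom (relGen f x) = h.hom (relGen f x)) : g = h := by
  refine relι_hom_ext f fun x => ?_
  ext r
  change g.hom ((relι f x).hom r) = h.hom ((relι f x).hom r)
  rw [relι_apply, map_smul, map_smul, H]

/-- The projection modulo `W` vanishes on the classes of simplices, hence everywhere. -/
lemma mem_of_relGen_mem {k : SimplexCategoryᵒᵖ}
    (W : Submodule R ((relativeModule (R := R) f).X₃.obj k)) (h : ∀ x, relGen f x ∈ W)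
    (z : (relativeModule (R := R) f).X₃.obj k) : z ∈ W := by
  have : ModuleCat.ofHom W.mkQ = 0 := hom_ext_relGen f fun x => by simpa using h x
  have h2 := congrArg ModuleCat.Hom.hom this
  rw [ModuleCat.hom_ofHom, ModuleCat.hom_zero] at h2
  have h3 : z ∈ W.mkQ.ker := by rw [h2]; exact LinearMap.mem_ker.2 rfl
  rwa [W.ker_mkQ] at h3

lemma d_relGen {k : ℕ} (x : B _⦋k + 1⦌) :
    (((AlgebraicTopology.alternatingFaceMapComplex _).obj
      (relativeModule (R := R) f).X₃).d (k + 1) k).hom (relGen f x) =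
      ∑ i : Fin (k + 2), (-1 : ℤ) ^ (i : ℕ) • relGen f (B.δ i x) := by
  have h := AlgebraicTopology.AlternatingFaceMapComplex.obj_d_eq (relativeModule (R := R) f).X₃ k
  refine (congrArg (fun g => g.hom (relGen f x)) h).trans ?_
  simp only [ModuleCat.hom_sum, LinearMap.sum_apply, ModuleCat.hom_zsmul, LinearMap.smul_apply]
  exact Finset.sum_congr rfl fun i _ => congrArg _ (map_relGen f _ x)

lemma PInfty_relGen_degenerate {k : ℕ} {m : SimplexCategory} (s : ⦋k⦌ ⟶ m) (hs : ¬ Mono s)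
    (y : B.obj (op m)) :
    (PInfty (X := (relativeModule (R := R) f).X₃).f k).hom (relGen f (B.map s.op y)) = 0 := by
  rw [← map_relGen]
  exact congrArg (fun g => g.hom (relGen f y))
    (degeneracy_comp_PInfty (relativeModule (R := R) f).X₃ k s hs)

end relative
end BousfieldHomology

/-! ### Relative homology of a triangle complex -/

namespace BousfieldHomology
open CategoryTheory Opposite Limits
open scoped Simplicial
open AlgebraicTopology.DoldKan

section
variable (R : Type v) [Ring R] {S N T : Type u} (d : T → Fin 3 → S ⊕ N)

/-- The relative normalized chain on an edge. -/
noncomputable def edgeChain : S ⊕ N → (N →₀ R) := Sum.elim 0 fun ν => Finsupp.single ν 1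

/-- The boundary map of the relative normalized chain complex of a triangle complex. -/
noncomputable def triangleBoundary : (T →₀ R) →ₗ[R] (N →₀ R) :=
  Finsupp.linearCombination R fun t =>
    edgeChain R (d t 0) - edgeChain R (d t 1) + edgeChain R (d t 2)

namespace triangleComplex

/-- This induces the left inverse of `relEdge` required by `exactAt_of_generators`; degenerate edges
and edges in `S` have value zero. -/
noncomputable def edgeLabel (x : (triangleComplex d) _⦋1⦌) : N →₀ R :=
  ((labeling d).app (op ⦋1⦌) x (0 : Fin 2) (1 : Fin 2)).elim 0 (edgeChain R)

lemma edgeLabel_edge (e : S ⊕ N) : edgeLabel R d (edge d e) = edgeChain R e := rfl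

lemma edgeLabel_inclusion (a : (wedge S) _⦋1⦌) :
    edgeLabel R d ((inclusion d Sum.inl).app _ a) = 0 := by
  obtain rfl | ⟨e, s, -, -, rfl, -, -⟩ := wedge_cases a
  · rfl
  · rw [inclusion_mk_edge, edgeLabel]
    have := labeling_mk_edge d (Sum.inl e) s 0 1
    refine (congrArg (fun o : Option (S ⊕ N) => o.elim 0 (edgeChain R)) this).trans ?_
    split_ifs <;> rfl

lemma edge_inl (s : S) : (inclusion d Sum.inl).app _ (edge _ s) = edge d (Sum.inl s) :=
  inclusion_edge ..

noncomputable def relEdge : (N →₀ R) →ₗ[R]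
    (relativeModule (R := R) (inclusion d Sum.inl)).X₃ _⦋1⦌ :=
  Finsupp.linearCombination R fun ν => relGen _ (edge d (Sum.inr ν))

noncomputable def relTriangle : (T →₀ R) →ₗ[R]
    (relativeModule (R := R) (inclusion d Sum.inl)).X₃ _⦋2⦌ :=
  Finsupp.linearCombination R fun t => relGen _ (triangle d t)

lemma relGen_edge (e : S ⊕ N) :
    relGen (R := R) (inclusion d Sum.inl) (edge d e) = relEdge R d (edgeChain R e) := by
  cases e with
  | inl s => rw [← edge_inl, relGen_app]; exact (map_zero _).symm
  | inr ν => simp [relEdge, edgeChain]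

lemma d_relTriangle (a : T →₀ R) :
    (((AlgebraicTopology.alternatingFaceMapComplex _).obj
      (relativeModule (R := R) (inclusion d Sum.inl)).X₃).d 2 1).hom (relTriangle R d a) =
      relEdge R d (triangleBoundary R d a) := by
  have : (((AlgebraicTopology.alternatingFaceMapComplex _).obj
      (relativeModule (R := R) (inclusion d Sum.inl)).X₃).d 2 1).hom ∘ₗ relTriangle R d =
      relEdge R d ∘ₗ triangleBoundary R d := by
    ext t
    simp only [LinearMap.comp_apply, Finsupp.lsingle_apply, relTriangle, triangleBoundary,
      Finsupp.linearCombination_single, one_smul]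
    refine (d_relGen _ (triangle d t)).trans ?_
    refine (Fin.sum_univ_three _).trans ?_
    simp only [δ_triangle, relGen_edge, map_add, map_sub]
    simp
    abel
  exact LinearMap.congr_fun this a

lemma PInfty_relGen (k : ℕ) (x : (triangleComplex d) _⦋k⦌) :
    (PInfty (X := (relativeModule (R := R) (inclusion d Sum.inl)).X₃).f k).hom (relGen _ x) = 0 ∨
      (∃ (h : k = 1) (e : _), x = mk d (.edge e (eqToHom (by rw [h])))) ∨
      (∃ (h : k = 2) (t : T), x = mk d (.triangle t (eqToHom (by rw [h])))) := by
  obtain ⟨m, s, y, hs, rfl⟩ | rfl | h := simplex_cases d x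
  · exact .inl (PInfty_relGen_degenerate _ s hs y)
  · left
    rw [← inclusion_mk_vertex d Sum.inl, relGen_app, map_zero]
  · exact .inr h

/-- If the relative normalized boundary map is bijective, then the inclusion of the wedge of
circles is a homology equivalence. -/
theorem isHomologyEquiv_inclusion (h : Function.Bijective (triangleBoundary R d)) :
    IsHomologyEquiv R (inclusion d Sum.inl) := by
  have hinj : ∀ k, Function.Injective ((inclusion d Sum.inl).app k) :=
    fun k => inclusion_injective d Sum.inl_injective k.unop
  refine isHomologyEquiv_of_exactAt _ hinj ?_
  obtain ⟨φ, hφ⟩ := exists_relι_desc (R := R) (inclusion d Sum.inl) hinj (k := op ⦋1⦌)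
    (V := ModuleCat.of.{max u v} R (N →₀ R))
    (fun x => ModuleCat.ofHom ((LinearMap.toSpanSingleton R _ (edgeLabel R d x)).comp
      ULift.moduleEquiv.toLinearMap))
    (fun a => by rw [edgeLabel_inclusion]; ext; simp)
  have hφ' : ∀ x, φ.hom (relGen _ x) = edgeLabel R d x := fun x => by
    refine (congrArg (fun g => ModuleCat.Hom.hom g (ULift.up (1 : R))) (hφ x)).trans ?_
    exact one_smul R _
  refine exactAt_of_generators _ (relEdge R d) (relTriangle R d) (triangleBoundary R d) h φ.hom
    ?_ ?_ ?_ ?_ (d_relTriangle R d)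
  · intro a
    have : φ.hom ∘ₗ relEdge R d = LinearMap.id := by
      ext1 ν
      ext1
      simp only [LinearMap.comp_apply, Finsupp.lsingle_apply, relEdge,
        Finsupp.linearCombination_single, one_smul, hφ', edgeLabel_edge]
      rfl
    exact LinearMap.congr_fun this a
  · intro k hk1 hk2
    refine hom_ext_relGen _ fun x => ?_
    obtain h | ⟨h, -⟩ | ⟨h, -⟩ := PInfty_relGen R d k x
    · exact h
    · exact absurd h hk1
    · exact absurd h hk2
  · intro z
    -- The chains whose normalization comes from `relEdge` form a submodule, so generators suffice.
    have := mem_of_relGen_mem _ (((LinearMap.range (relEdge R d)).map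
      (PInfty (X := (relativeModule (R := R) (inclusion d Sum.inl)).X₃).f 1).hom).comap
      (PInfty (X := (relativeModule (R := R) (inclusion d Sum.inl)).X₃).f 1).hom) (fun x => ?_) z
    · obtain ⟨_, ⟨a, rfl⟩, ha⟩ := this
      exact ⟨a, ha.symm⟩
    · obtain h | ⟨h, e, rfl⟩ | ⟨h, -⟩ := PInfty_relGen R d 1 x
      · rw [Submodule.mem_comap, h]
        exact zero_mem _
      · exact ⟨_, ⟨_, (relGen_edge R d e).symm⟩, rfl⟩
      · cases h
  · intro z
    have := mem_of_relGen_mem _ (((LinearMap.range (relTriangle R d)).map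
      (PInfty (X := (relativeModule (R := R) (inclusion d Sum.inl)).X₃).f 2).hom).comap
      (PInfty (X := (relativeModule (R := R) (inclusion d Sum.inl)).X₃).f 2).hom) (fun x => ?_) z
    · obtain ⟨_, ⟨a, rfl⟩, ha⟩ := this
      exact ⟨a, ha.symm⟩
    · obtain h | ⟨h, -⟩ | ⟨h, t, rfl⟩ := PInfty_relGen R d 2 x
      · rw [Submodule.mem_comap, h]
        exact zero_mem _
      · cases h
      · exact ⟨_, ⟨Finsupp.single t 1, (Finsupp.linearCombination_single ..).trans
          (one_smul R _)⟩, rfl⟩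

end triangleComplex
end
end BousfieldHomology

/-! ### Path homotopies, singular triangles and squares -/

namespace BousfieldHomology
open unitInterval
open scoped Topology

section paths
variable {X : Type*} [TopologicalSpace X]

/-- Paths along the boundary of a contractible parameter space give homotopic images. -/
lemma homotopic_of_factor {Y : Type*} [TopologicalSpace Y] [SimplyConnectedSpace Y] (K : C(Y, X))
    {y z : Y} {x x' : X} (p q : Path y z) (p' q' : Path x x') (hp : ∀ t, p' t = K (p t))
    (hq : ∀ t, q' t = K (q t)) : p'.Homotopic q' := by
  obtain rfl : x = K y := by rw [← p'.source, hp, p.source]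
  obtain rfl : x' = K z := by rw [← p'.target, hp, p.target]
  obtain rfl : p' = p.map K.continuous := Path.ext (funext hp)
  obtain rfl : q' = q.map K.continuous := Path.ext (funext hq)
  exact (SimplyConnectedSpace.paths_homotopic p q).map K

lemma trans_apply_eq {Y : Type*} [TopologicalSpace Y] (K : Y → X) {y y' y'' : Y} {x x' x'' : X}
    {p : Path y y'} {q : Path y' y''} {p' : Path x x'} {q' : Path x' x''}
    (hp : ∀ t, p' t = K (p t)) (hq : ∀ t, q' t = K (q t)) (t : I) :
    p'.trans q' t = K (p.trans q t) := by
  rw [Path.trans_apply, Path.trans_apply]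
  split_ifs
  · exact hp _
  · exact hq _

/-- The two routes around the contractible square `I × I` are homotopic, and `K` carries them to the
two sides. -/
lemma homotopic_of_square (K : C(I × I, X)) {x₀₀ x₀₁ x₁₀ x₁₁ : X} {l : Path x₀₀ x₀₁}
    {r : Path x₁₀ x₁₁} {b : Path x₀₀ x₁₀} {t : Path x₀₁ x₁₁} (hl : ∀ s, l s = K (0, s))
    (hr : ∀ s, r s = K (1, s)) (hb : ∀ s, b s = K (s, 0)) (ht : ∀ s, t s = K (s, 1)) :
    (b.trans r).Homotopic (l.trans t) := by
  have : ContractibleSpace I := (convex_Icc (0 : ℝ) 1).contractibleSpace ⟨0, by simp⟩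
  let sg : Path (0 : I) 1 := ⟨⟨id, continuous_id⟩, rfl, rfl⟩
  refine homotopic_of_factor K ((sg.prod (.refl 0)).trans ((Path.refl 1).prod sg))
    (((Path.refl 0).prod sg).trans (sg.prod (.refl 1))) _ _
    (trans_apply_eq K ?_ ?_) (trans_apply_eq K ?_ ?_)
  exacts [hb, hr, hl, ht]

end paths

section simplex
variable {X : Type*} [TopologicalSpace X]

/-- This form agrees by definition with the face operator on singular triangles, see `edgeEquiv_δ`.
-/
noncomputable def faceMap (i : Fin 3) : C(I, stdSimplex ℝ (Fin 3)) :=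
  .comp ⟨stdSimplex.map i.succAbove, stdSimplex.continuous_map _⟩
    (stdSimplexHomeomorphUnitInterval.symm : C(I, stdSimplex ℝ (Fin 2)))

lemma faceMap_apply (i : Fin 3) (t : I) (j : Fin 3) :
    faceMap i t j = (if i.succAbove 0 = j then 1 - (t : ℝ) else 0) +
      if i.succAbove 1 = j then (t : ℝ) else 0 := by
  refine (FunOnFinite.linearMap_apply_apply ..).trans ?_
  rw [Finset.sum_filter, Fin.sum_univ_two]
  rfl

/-- The barycentric coordinates of `squareToTriangle`. -/
noncomputable def squareToTriangleFun (p : I × I) : Fin 3 → ℝ :=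
  -- As `p.1` goes from 0 to 1, the broken path through vertex 1 is pushed onto the edge from vertex
  -- 0 to vertex 2. The weight removed from vertex 1 is split equally, so `p.2` is always coordinate
  -- 2 plus half of coordinate 1.
  ![1 - (p.2 : ℝ) - (1 - (p.1 : ℝ)) * min (2 * (p.2 : ℝ)) (2 - 2 * (p.2 : ℝ)) / 2,
    (1 - (p.1 : ℝ)) * min (2 * (p.2 : ℝ)) (2 - 2 * (p.2 : ℝ)),
    (p.2 : ℝ) - (1 - (p.1 : ℝ)) * min (2 * (p.2 : ℝ)) (2 - 2 * (p.2 : ℝ)) / 2]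

lemma squareToTriangleFun_mem (p : I × I) : squareToTriangleFun p ∈ stdSimplex ℝ (Fin 3) := by
  obtain ⟨⟨a, ha0, ha1⟩, ⟨s, hs0, hs1⟩⟩ := p
  have h1 := min_le_left (2 * s) (2 - 2 * s)
  have h2 := min_le_right (2 * s) (2 - 2 * s)
  have h0 : 0 ≤ min (2 * s) (2 - 2 * s) := le_min (by linarith) (by linarith)
  simp only [squareToTriangleFun]
  set m := min (2 * s) (2 - 2 * s)
  have h3 : 0 ≤ (1 - a) * m := mul_nonneg (by linarith) h0
  have h4 : (1 - a) * m ≤ m := by nlinarith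
  refine ⟨fun j => ?_, ?_⟩
  · fin_cases j <;> simp <;> linarith
  · simp [Fin.sum_univ_three]
    ring

/-- A map from the square that collapses two opposite sides of it to vertices of the triangle. -/
noncomputable def squareToTriangle : C(I × I, stdSimplex ℝ (Fin 3)) where
  toFun p := ⟨squareToTriangleFun p, squareToTriangleFun_mem p⟩
  continuous_toFun := by
    refine Continuous.subtype_mk (continuous_pi fun j => ?_) _
    fin_cases j <;> simp [squareToTriangleFun] <;> fun_prop

lemma squareToTriangle_surjective : Function.Surjective squareToTriangle := by
  intro z
  have h0 := z.2.1 0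
  have h1 := z.2.1 1
  have h2 := z.2.1 2
  have hs := z.2.2
  rw [Fin.sum_univ_three] at hs
  obtain ⟨z, hz⟩ := z
  simp only at *
  have hm : z 1 ≤ min (2 * (z 1 / 2 + z 2)) (2 - 2 * (z 1 / 2 + z 2)) :=
    le_min (by linarith) (by linarith)
  set m := min (2 * (z 1 / 2 + z 2)) (2 - 2 * (z 1 / 2 + z 2)) with hmdef
  have hm0 : 0 ≤ m := h1.trans hm
  -- If `m = 0`, then `z 1 = 0` and the convention `z 1 / 0 = 0` selects the parameter 1.
  have key : (1 - (1 - z 1 / m)) * m = z 1 := by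
    rcases hm0.eq_or_lt with h | h
    · rw [← h] at hm ⊢; linarith
    · field_simp; ring
  refine ⟨(⟨1 - z 1 / m, ?_, ?_⟩, ⟨z 1 / 2 + z 2, by linarith, by linarith⟩), ?_⟩
  · linarith [div_le_one_of_le₀ hm hm0]
  · linarith [div_nonneg h1 hm0]
  · refine Subtype.ext (funext fun j => ?_)
    simp only [squareToTriangle, squareToTriangleFun, ContinuousMap.coe_mk]
    rw [← hmdef, key]
    fin_cases j <;> simp <;> linarith

/-- Only the sides `p.2 = 0` and `p.2 = 1` are collapsed. A path homotopy is constant on both, so it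
descends to the triangle. -/
lemma squareToTriangle_fiber {p q : I × I} (h : squareToTriangle p = squareToTriangle q) :
    p.2 = q.2 ∧ (p.1 = q.1 ∨ p.2 = 0 ∨ p.2 = 1) := by
  have h1 : squareToTriangle p 1 = squareToTriangle q 1 := by rw [h]
  have h2 : squareToTriangle p 2 = squareToTriangle q 2 := by rw [h]
  replace h1 : (1 - p.1 : ℝ) * min (2 * (p.2 : ℝ)) (2 - 2 * p.2) =
    (1 - q.1) * min (2 * (q.2 : ℝ)) (2 - 2 * q.2) := h1
  replace h2 : (p.2 : ℝ) - (1 - p.1 : ℝ) * min (2 * (p.2 : ℝ)) (2 - 2 * p.2) / 2 =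
    q.2 - (1 - q.1) * min (2 * (q.2 : ℝ)) (2 - 2 * q.2) / 2 := h2
  have h3 : (p.2 : ℝ) = q.2 := by linarith
  refine ⟨Subtype.ext h3, ?_⟩
  rw [← h3] at h1
  rcases mul_eq_mul_right_iff.1 h1 with h | h
  · exact .inl (Subtype.ext (by linarith))
  · right
    rcases min_choice (2 * (p.2 : ℝ)) (2 - 2 * p.2) with h' | h' <;> rw [h'] at h
    · exact .inl (Subtype.ext (by simpa using h))
    · exact .inr (Subtype.ext (show (p.2 : ℝ) = 1 by linarith))

lemma squareToTriangle_zero_half (t s : I) (hs : (s : ℝ) = t / 2) :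
    squareToTriangle (0, s) = faceMap 2 t := by
  have ht := t.2.2
  have hm : min (2 * (s : ℝ)) (2 - 2 * s) = t := by
    rw [hs, min_eq_left] <;> linarith
  refine Subtype.ext (funext fun j => ?_)
  refine Eq.trans ?_ (faceMap_apply 2 t j).symm
  simp only [squareToTriangle, squareToTriangleFun, ContinuousMap.coe_mk, hm]
  fin_cases j <;> simp [hs, Fin.succAbove] <;> ring

lemma squareToTriangle_half_one (t s : I) (hs : (s : ℝ) = (1 + t) / 2) :
    squareToTriangle (0, s) = faceMap 0 t := by
  have ht := t.2.1
  have hm : min (2 * (s : ℝ)) (2 - 2 * s) = 1 - t := by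
    rw [hs, min_eq_right] <;> linarith
  refine Subtype.ext (funext fun j => ?_)
  refine Eq.trans ?_ (faceMap_apply 0 t j).symm
  simp only [squareToTriangle, squareToTriangleFun, ContinuousMap.coe_mk, hm]
  fin_cases j <;> simp [hs] <;> ring

lemma squareToTriangle_one (t : I) : squareToTriangle (1, t) = faceMap 1 t := by
  refine Subtype.ext (funext fun j => ?_)
  refine Eq.trans ?_ (faceMap_apply 1 t j).symm
  fin_cases j <;> simp [squareToTriangle, squareToTriangleFun, Fin.succAbove]

/-- A homotopy between a concatenation of two paths and a third path gives a singular
triangle with these paths as faces. -/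
lemma exists_triangle {x₀ x₁ x₂ : X} {a : Path x₀ x₁} {b : Path x₁ x₂} {c : Path x₀ x₂}
    (h : (a.trans b).Homotopic c) : ∃ ρ : C(stdSimplex ℝ (Fin 3), X),
      (∀ t, ρ (faceMap 2 t) = a t) ∧ (∀ t, ρ (faceMap 0 t) = b t) ∧
        ∀ t, ρ (faceMap 1 t) = c t := by
  obtain ⟨F⟩ := h
  -- A continuous surjection from a compact space onto a Hausdorff space is a quotient map.
  have hq : Topology.IsQuotientMap squareToTriangle :=
    squareToTriangle.continuous.isClosedMap.isQuotientMap squareToTriangle.continuous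
      squareToTriangle_surjective
  have hF : Function.FactorsThrough F.toContinuousMap squareToTriangle := fun p q hpq => by
    obtain ⟨h2, h1⟩ := squareToTriangle_fiber hpq
    obtain ⟨p1, p2⟩ := p
    obtain ⟨q1, q2⟩ := q
    simp only at h1 h2
    obtain rfl := h2
    rcases h1 with rfl | rfl | rfl
    · rfl
    · exact (F.source _).trans (F.source _).symm
    · exact (F.target _).trans (F.target _).symm
  let ρ := hq.lift F.toContinuousMap hF
  have hρ : ∀ p, ρ (squareToTriangle p) = F p := fun p =>
    congrArg (fun g : C(I × I, X) => g p) (hq.lift_comp F.toContinuousMap hF)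
  refine ⟨ρ, fun t => ?_, fun t => ?_, fun t => ?_⟩
  · have hs : (t / 2 : ℝ) ∈ I := ⟨by linarith [t.2.1], by linarith [t.2.2]⟩
    rw [← squareToTriangle_zero_half t ⟨t / 2, hs⟩ rfl, hρ, F.apply_zero]
    refine (Path.trans_apply ..).trans ((dif_pos (by linarith [t.2.2] : (t / 2 : ℝ) ≤ 1 / 2)).trans
      (congrArg a (Subtype.ext ?_)))
    show (2 * (t / 2) : ℝ) = t
    ring
  · have hs : ((1 + t) / 2 : ℝ) ∈ I := ⟨by linarith [t.2.1], by linarith [t.2.2]⟩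
    rw [← squareToTriangle_half_one t ⟨(1 + t) / 2, hs⟩ rfl, hρ, F.apply_zero]
    refine (Path.trans_apply ..).trans ?_
    split_ifs with h
    -- At the midpoint `Path.trans` uses its first branch; both branches give `x₁`.
    · have ht : (t : ℝ) = 0 := le_antisymm (by linarith [show ((1 + t) / 2 : ℝ) ≤ 1 / 2 from h]) t.2.1
      obtain rfl : t = 0 := Subtype.ext ht
      rw [b.source]
      refine Eq.trans (congrArg a (Subtype.ext ?_)) a.target
      simp
    · refine congrArg b (Subtype.ext ?_)
      show (2 * ((1 + t) / 2) - 1 : ℝ) = t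
      ring
  · rw [← squareToTriangle_one, hρ, F.apply_one]
    rfl

/-- The faces of a singular triangle satisfy the homotopy relation. -/
lemma homotopic_of_triangle (ρ : C(stdSimplex ℝ (Fin 3), X)) {x₀ x₁ x₂ : X} {a : Path x₀ x₁}
    {b : Path x₁ x₂} {c : Path x₀ x₂} (ha : ∀ t, a t = ρ (faceMap 2 t))
    (hb : ∀ t, b t = ρ (faceMap 0 t)) (hc : ∀ t, c t = ρ (faceMap 1 t)) :
    (a.trans b).Homotopic c := by
  have : ContractibleSpace (stdSimplex ℝ (Fin 3)) :=
    (convex_stdSimplex ℝ (Fin 3)).contractibleSpace ⟨_, single_mem_stdSimplex ℝ 0⟩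
  let v : Fin 3 → stdSimplex ℝ (Fin 3) := fun i => stdSimplex.vertex i
  have h : ∀ i : Fin 3, faceMap i 0 = v (i.succAbove 0) ∧ faceMap i 1 = v (i.succAbove 1) := by
    intro i
    constructor <;> refine Subtype.ext (funext fun j => (faceMap_apply i _ j).trans ?_) <;>
      simp [v, Pi.single_apply, eq_comm]
  let p : Path (v 0) (v 1) := ⟨faceMap 2, (h 2).1, (h 2).2⟩
  let q : Path (v 1) (v 2) := ⟨faceMap 0, (h 0).1, (h 0).2⟩
  let r : Path (v 0) (v 2) := ⟨faceMap 1, (h 1).1, (h 1).2⟩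
  exact homotopic_of_factor ρ (p.trans q) r _ _ (trans_apply_eq ρ ha hb) hc

/-- The fold of the square along its diagonal. -/
noncomputable def foldSquare : C(I × I, stdSimplex ℝ (Fin 3)) where
  toFun p := ⟨![1 - max (p.1 : ℝ) p.2, max (p.1 : ℝ) p.2 - min (p.1 : ℝ) p.2,
      min (p.1 : ℝ) p.2], by
    have h1 := max_le p.1.2.2 p.2.2.2
    have h2 := le_min p.1.2.1 p.2.2.1
    have h3 := min_le_max (a := (p.1 : ℝ)) (b := p.2)
    refine ⟨fun j => ?_, ?_⟩
    · fin_cases j <;> simp only [Fin.zero_eta, Fin.mk_one, Fin.reduceFinMk, Matrix.cons_val] <;> linarith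
    · simp [Fin.sum_univ_three]⟩
  continuous_toFun := by
    refine Continuous.subtype_mk (continuous_pi fun j => ?_) _
    fin_cases j <;> simp <;> fun_prop

lemma foldSquare_eq (p : I × I) (i : Fin 3) (t : I)
    (h : ![1 - max (p.1 : ℝ) p.2, max (p.1 : ℝ) p.2 - min (p.1 : ℝ) p.2, min (p.1 : ℝ) p.2] =
      fun j => (if i.succAbove 0 = j then 1 - (t : ℝ) else 0) +
        if i.succAbove 1 = j then (t : ℝ) else 0) : foldSquare p = faceMap i t :=
  Subtype.ext (h.trans (funext fun j => (faceMap_apply i t j).symm))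

/-- A homotopy relation between the sides of a square gives a filling of the square. -/
lemma exists_square {x₀₀ x₀₁ x₁₀ x₁₁ : X} {l : Path x₀₀ x₀₁}
    {r : Path x₁₀ x₁₁} {b : Path x₀₀ x₁₀} {t : Path x₀₁ x₁₁}
    (h : (b.trans r).Homotopic (l.trans t)) : ∃ K : C(I × I, X),
    (∀ s, K (0, s) = l s) ∧ (∀ s, K (1, s) = r s) ∧ (∀ s, K (s, 0) = b s) ∧
      (∀ s, K (s, 1) = t s) := by
  -- Both triangles have `b.trans r` as their long side, so they glue along the diagonal.
  obtain ⟨ρ, h1, h2, h3⟩ := exists_triangle (Path.Homotopic.refl (b.trans r))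
  obtain ⟨ρ', h1', h2', h3'⟩ := exists_triangle h.symm
  have hb : ∀ s : I, foldSquare (s, 0) = faceMap 2 s := fun s => foldSquare_eq _ _ _ (by
    have := s.2.1
    ext j; fin_cases j <;> simp [this, Fin.succAbove])
  have hl : ∀ s : I, foldSquare (0, s) = faceMap 2 s := fun s => foldSquare_eq _ _ _ (by
    have := s.2.1
    ext j; fin_cases j <;> simp [this, Fin.succAbove])
  have hr : ∀ s : I, foldSquare (1, s) = faceMap 0 s := fun s => foldSquare_eq _ _ _ (by
    have := s.2.2
    ext j; fin_cases j <;> simp [this])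
  have ht : ∀ s : I, foldSquare (s, 1) = faceMap 0 s := fun s => foldSquare_eq _ _ _ (by
    have := s.2.2
    ext j; fin_cases j <;> simp [this])
  have hd : ∀ s : I, foldSquare (s, s) = faceMap 1 s := fun s => foldSquare_eq _ _ _ (by
    ext j; fin_cases j <;> simp [Fin.succAbove])
  refine ⟨⟨fun p => if p.2 ≤ p.1 then ρ (foldSquare p) else ρ' (foldSquare p), ?_⟩,
    fun s => ?_, fun s => ?_, fun s => ?_, fun s => ?_⟩
  · refine Continuous.if_le (by fun_prop) (by fun_prop) continuous_snd continuous_fst ?_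
    rintro ⟨u, w⟩ (rfl : w = u)
    rw [hd, h3, h3']
  · rw [ContinuousMap.coe_mk, hl]
    split_ifs with h
    · obtain rfl : s = 0 := le_antisymm h s.2.1
      rw [h1, b.source, l.source]
    · exact h1' s
  · rw [ContinuousMap.coe_mk, hr, if_pos (show s ≤ 1 from s.2.2), h2]
  · rw [ContinuousMap.coe_mk, hb, if_pos (show 0 ≤ s from s.2.1), h1]
  · rw [ContinuousMap.coe_mk, ht]
    split_ifs with h
    · obtain rfl : s = 1 := le_antisymm s.2.2 h
      rw [h2, r.target, t.target]
    · exact h2' s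
end simplex
end BousfieldHomology

/-! ### Loops and maps on the realization -/

namespace BousfieldHomology
open CategoryTheory Opposite unitInterval
open scoped Simplicial

section singular
variable {Y : TopCat.{u}}

/-- Singular edges are continuous maps out of the unit interval. -/
noncomputable def edgeEquiv : (TopCat.toSSet.obj Y) _⦋1⦌ ≃ C(I, Y) :=
  (TopCat.toSSetObjEquiv Y (op ⦋1⦌)).trans
    (stdSimplexHomeomorphUnitInterval.continuousMapCongr (.refl Y))

/-- Singular triangles are continuous maps out of the standard triangle. -/
noncomputable def triangleEquiv : (TopCat.toSSet.obj Y) _⦋2⦌ ≃ C(stdSimplex ℝ (Fin 3), Y) :=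
  TopCat.toSSetObjEquiv Y (op ⦋2⦌)

lemma edgeEquiv_δ (x : (TopCat.toSSet.obj Y) _⦋2⦌) (i : Fin 3) (t : I) :
    edgeEquiv ((TopCat.toSSet.obj Y).δ i x) t = triangleEquiv x (faceMap i t) := rfl

lemma edgeEquiv_zero (x : (TopCat.toSSet.obj Y) _⦋1⦌) :
    edgeEquiv x 0 = TopCat.toSSetObj₀Equiv ((TopCat.toSSet.obj Y).δ 1 x) := by
  rw [TopCat.toSSetObj₀Equiv_apply]
  refine congrArg (TopCat.toSSetObjEquiv Y (op ⦋1⦌) x) ?_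
  refine stdSimplexHomeomorphUnitInterval.symm_apply_eq.2 ?_
  refine Subtype.ext ?_
  change (0 : ℝ) = FunOnFinite.linearMap ℝ ℝ (Fin.succAbove (1 : Fin 2)) (fun _ : Fin 1 => (1 : ℝ)) 1
  rw [FunOnFinite.linearMap_apply_apply, Finset.sum_filter]
  simp

lemma edgeEquiv_one (x : (TopCat.toSSet.obj Y) _⦋1⦌) :
    edgeEquiv x 1 = TopCat.toSSetObj₀Equiv ((TopCat.toSSet.obj Y).δ 0 x) := by
  rw [TopCat.toSSetObj₀Equiv_apply]
  refine congrArg (TopCat.toSSetObjEquiv Y (op ⦋1⦌) x) ?_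
  refine stdSimplexHomeomorphUnitInterval.symm_apply_eq.2 ?_
  refine Subtype.ext ?_
  change (1 : ℝ) = FunOnFinite.linearMap ℝ ℝ (Fin.succAbove (0 : Fin 2)) (fun _ : Fin 1 => (1 : ℝ)) 1
  rw [FunOnFinite.linearMap_apply_apply, Finset.sum_filter]
  simp

lemma edgeEquiv_map {Z : TopCat.{u}} (f : Y ⟶ Z) (x : (TopCat.toSSet.obj Y) _⦋1⦌) (t : I) :
    edgeEquiv ((TopCat.toSSet.map f).app _ x) t = f (edgeEquiv x t) := rfl

lemma toSSetObj₀Equiv_map {Z : TopCat.{u}} (f : Y ⟶ Z) (x : (TopCat.toSSet.obj Y) _⦋0⦌) :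
    TopCat.toSSetObj₀Equiv ((TopCat.toSSet.map f).app _ x) = f (TopCat.toSSetObj₀Equiv x) := rfl

/-- The unit of the adjunction between realization and singular simplices. -/
noncomputable def toSingular (A : SSet.{u}) : A ⟶ TopCat.toSSet.obj (SSet.toTop.obj A) :=
  sSetTopAdj.unit.app A

lemma toSingular_naturality {A B : SSet.{u}} (f : A ⟶ B) {k : SimplexCategoryᵒᵖ} (x : A.obj k) :
    (TopCat.toSSet.map (SSet.toTop.map f)).app k ((toSingular A).app k x) =
      (toSingular B).app k (f.app k x) := by
  have h : f ≫ toSingular B = toSingular A ≫ TopCat.toSSet.map (SSet.toTop.map f) :=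
    sSetTopAdj.unit.naturality f
  have h' := ConcreteCategory.congr_hom (NatTrans.congr_app h k) x
  rw [NatTrans.comp_app, NatTrans.comp_app] at h'
  exact h'.symm

/-- Maps out of the realization correspond to maps to the singular simplicial set. -/
noncomputable def realizationEquiv (A : SSet.{u}) (Y : TopCat.{u}) :
    (SSet.toTop.obj A ⟶ Y) ≃ (A ⟶ TopCat.toSSet.obj Y) :=
  sSetTopAdj.homEquiv A Y

lemma realizationEquiv_apply {A : SSet.{u}} (f : SSet.toTop.obj A ⟶ Y) :
    realizationEquiv A Y f = toSingular A ≫ TopCat.toSSet.map f :=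
  Adjunction.homEquiv_unit ..

lemma realizationEquiv_app {A : SSet.{u}} (f : SSet.toTop.obj A ⟶ Y) {k : SimplexCategoryᵒᵖ}
    (x : A.obj k) : (realizationEquiv A Y f).app k x =
      (TopCat.toSSet.map f).app k ((toSingular A).app k x) := by
  rw [realizationEquiv_apply]
  rfl

end singular

namespace triangleComplex
variable {E T : Type u} (d : T → Fin 3 → E)

/-- The basepoint of the realization. -/
noncomputable def basePoint : SSet.toTop.obj (triangleComplex d) :=
  TopCat.toSSetObj₀Equiv ((toSingular (triangleComplex d)).app _ (vertex d))

/-- The loop in the realization given by an edge. -/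
noncomputable def edgeLoop (e : E) : Path (basePoint d) (basePoint d) where
  toContinuousMap := edgeEquiv ((toSingular (triangleComplex d)).app _ (edge d e))
  source' := by
    refine (edgeEquiv_zero _).trans (congrArg _ ?_)
    rw [← SSet.δ_naturality_apply, δ_edge]
  target' := by
    refine (edgeEquiv_one _).trans (congrArg _ ?_)
    rw [← SSet.δ_naturality_apply, δ_edge]

lemma edgeLoop_apply (e : E) (t : I) : edgeLoop d e t =
    edgeEquiv ((toSingular (triangleComplex d)).app _ (edge d e)) t := rfl

lemma edgeLoop_homotopic (t : T) : ((edgeLoop d (d t 2)).trans (edgeLoop d (d t 0))).Homotopic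
    (edgeLoop d (d t 1)) := by
  have h : ∀ i s, edgeLoop d (d t i) s =
      triangleEquiv ((toSingular (triangleComplex d)).app _ (triangle d t))
        (faceMap i s) := fun i s => by
    rw [← edgeEquiv_δ, edgeLoop_apply, ← δ_triangle]
    rw [SSet.δ_naturality_apply]
  exact homotopic_of_triangle _ (h 2) (h 0) (h 1)

section
variable {X : Type u} [TopologicalSpace X]

lemma realizationEquiv_apply_edge (f : SSet.toTop.obj (triangleComplex d) ⟶ TopCat.of X) (e : E) (t : I) :
    edgeEquiv ((realizationEquiv _ _ f).app _ (edge d e)) t = f (edgeLoop d e t) := by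
  rw [realizationEquiv_app]
  rfl

lemma realizationEquiv_apply_vertex (f : SSet.toTop.obj (triangleComplex d) ⟶ TopCat.of X) :
    TopCat.toSSetObj₀Equiv ((realizationEquiv _ _ f).app _ (vertex d)) = f (basePoint d) := by
  rw [realizationEquiv_app]
  rfl

/-- Loops satisfying the homotopy relations given by the triangles extend to the realization. -/
lemma exists_extension {x : X} (γ : E → Path x x)
    (hγ : ∀ t, ((γ (d t 2)).trans (γ (d t 0))).Homotopic (γ (d t 1))) :
    ∃ h : MappingSpace (triangleComplex d) X, h (basePoint d) = x ∧
      ∀ e s, h (edgeLoop d e s) = γ e s := by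
  choose ρ h2 h0 h1 using fun t => exists_triangle (hγ t)
  let g : triangleComplex d ⟶ TopCat.toSSet.obj (TopCat.of X) :=
    desc (TopCat.toSSetObj₀Equiv.symm (show TopCat.of X from x))
      (fun e => edgeEquiv.symm (γ e).toContinuousMap) (fun t => triangleEquiv.symm (ρ t))
      (fun e i => by
        apply TopCat.toSSetObj₀Equiv.injective
        rw [Equiv.apply_symm_apply]
        fin_cases i
        · refine (edgeEquiv_one _).symm.trans ?_
          rw [Equiv.apply_symm_apply]
          exact (γ e).target
        · refine (edgeEquiv_zero _).symm.trans ?_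
          rw [Equiv.apply_symm_apply]
          exact (γ e).source)
      (fun t i => by
        apply edgeEquiv.injective
        ext s
        rw [edgeEquiv_δ, Equiv.apply_symm_apply, Equiv.apply_symm_apply]
        fin_cases i
        exacts [h0 t s, h1 t s, h2 t s])
  refine ⟨((realizationEquiv _ _).symm g).hom, ?_, fun e s => ?_⟩
  · refine (realizationEquiv_apply_vertex d ((realizationEquiv _ _).symm g)).symm.trans ?_
    rw [Equiv.apply_symm_apply, desc_vertex, Equiv.apply_symm_apply]
  · refine (realizationEquiv_apply_edge d ((realizationEquiv _ _).symm g) e s).symm.trans ?_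
    rw [Equiv.apply_symm_apply, desc_edge, Equiv.apply_symm_apply]
    rfl

lemma mappingSpace_wedge_ext {S : Type u} {h h' : MappingSpace (wedge S) X}
    (hb : h (basePoint _) = h' (basePoint _))
    (he : ∀ s t, h (edgeLoop _ s t) = h' (edgeLoop _ s t)) : h = h' := by
  suffices TopCat.ofHom h = TopCat.ofHom h' from congrArg TopCat.Hom.hom this
  apply (realizationEquiv (wedge S) (TopCat.of X)).injective
  refine hom_ext ?_ (fun e => ?_) (fun t => t.elim)
  · apply TopCat.toSSetObj₀Equiv.injective
    rw [realizationEquiv_apply_vertex, realizationEquiv_apply_vertex]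
    exact hb
  · apply edgeEquiv.injective
    ext t
    rw [realizationEquiv_apply_edge, realizationEquiv_apply_edge]
    exact he e t

end

lemma map_inclusion_basePoint {S : Type u} (i : S → E) :
    SSet.toTop.map (inclusion d i) (basePoint _) = basePoint d := by
  rw [basePoint, ← toSSetObj₀Equiv_map, toSingular_naturality, inclusion_vertex, basePoint]

lemma map_inclusion_edgeLoop {S : Type u} (i : S → E) (s : S) (t : I) :
    SSet.toTop.map (inclusion d i) (edgeLoop _ s t) = edgeLoop d (i s) t := by
  rw [edgeLoop_apply, ← edgeEquiv_map, toSingular_naturality, inclusion_edge, edgeLoop_apply]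

end triangleComplex
end BousfieldHomology

/-! ### Unique solvability of equations in local spaces -/

namespace BousfieldHomology
open CategoryTheory Opposite unitInterval
open scoped Simplicial

section
variable {X Y : Type*} [TopologicalSpace X] [TopologicalSpace Y]

lemma homotopic_map_of_eq {y y' : Y} {P Q : Path y y'} (h : P.Homotopic Q) (K : C(Y, X)) {x x' : X}
    {p q : Path x x'} (hp : ∀ t, p t = K (P t)) (hq : ∀ t, q t = K (Q t)) : p.Homotopic q := by
  obtain rfl : x = K y := by rw [← p.source, hp, P.source]
  obtain rfl : x' = K y' := by rw [← p.target, hp, P.target]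
  obtain rfl : p = P.map K.continuous := Path.ext (funext hp)
  obtain rfl : q = Q.map K.continuous := Path.ext (funext hq)
  exact h.map K

lemma exists_path_of_pi0Map_eq {f : C(Y, X)} {y y' : Y} (hf : Function.Injective (pi0Map f))
    (h : f y = f y') : Nonempty (Path y y') :=
  Quotient.exact (hf (a₁ := Quotient.mk _ y) (a₂ := Quotient.mk _ y')
    (congrArg (Quotient.mk _) h))

lemma exists_path_of_pi0Map_surjective {f : C(Y, X)} (hf : Function.Surjective (pi0Map f))
    (x : X) : ∃ y, Nonempty (Path (f y) x) := by
  obtain ⟨⟨y⟩, hy⟩ := hf (Quotient.mk _ x)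
  exact ⟨y, Quotient.exact hy⟩

lemma exists_loop_of_homotopyGroupMap_surjective {f : C(Y, X)} {y : Y}
    (hf : Function.Surjective (homotopyGroupMap (Fin 1) f y)) (Q : Path (f y) (f y)) :
    ∃ P : Path y y, (P.map f.continuous).Homotopic Q := by
  obtain ⟨⟨z⟩, hz⟩ := hf (Quotient.mk _ ((genLoopEquivOfUnique (Fin 1)).symm Q))
  refine ⟨genLoopEquivOfUnique (Fin 1) z, ?_⟩
  have h := congrArg (homotopyGroupEquivFundamentalGroupOfUnique (Fin 1)) hz
  have h' := Quotient.exact h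
  rw [Equiv.apply_symm_apply] at h'
  exact h'

/-- A free homotopy of paths is a homotopy relative to the paths traced by the endpoints. -/
lemma homotopic_of_tracePath {h h' : C(Y, X)} (P : Path h h') {y y' : Y} (l : Path y y')
    {x₀₀ x₀₁ x₁₀ x₁₁ : X} {p : Path x₀₀ x₁₀} {p' : Path x₀₁ x₁₁} {a : Path x₀₀ x₀₁}
    {b : Path x₁₀ x₁₁} (hp : ∀ t, p t = P t y) (hp' : ∀ t, p' t = P t y')
    (ha : ∀ t, a t = h (l t)) (hb : ∀ t, b t = h' (l t)) :
    (p.trans b).Homotopic (a.trans p') := by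
  let Q : C(I, C(I, X)) := ⟨fun t => (P t).comp l.toContinuousMap,
    (ContinuousMap.continuous_precomp _).comp P.continuous⟩
  refine homotopic_of_square Q.uncurry ?_ ?_ ?_ ?_ <;> intro s <;> simp [Q, *]

/-- The hypothesis says that `b` is the conjugate of `a` by `p`, with the inverse cleared. -/
lemma FundamentalGroup.fundamentalGroupMulEquivOfPath_eq {x₀ x₁ : X} {p : Path x₀ x₁}
    {a : Path x₀ x₀} {b : Path x₁ x₁} (h : (p.trans b).Homotopic (a.trans p)) :
    FundamentalGroup.fundamentalGroupMulEquivOfPath p (Path.Homotopic.Quotient.mk a) =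
      Path.Homotopic.Quotient.mk b := by
  refine (Iso.conj_apply _ _).trans ?_
  rw [Iso.inv_comp_eq]
  exact (Path.Homotopic.Quotient.eq.2 h).symm

end

section
variable {R : Type v} [Ring R] {X : Type u} [TopologicalSpace X] {S N T : Type u}
  {d : T → Fin 3 → S ⊕ N}

open triangleComplex

lemma restrict_inclusion_ext {f g : MappingSpace (triangleComplex d) X}
    (hb : f (basePoint d) = g (basePoint d))
    (he : ∀ s t, f (edgeLoop d (.inl s) t) = g (edgeLoop d (.inl s) t)) :
    restrict (inclusion d Sum.inl) X f = restrict (inclusion d Sum.inl) X g := by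
  have key (f : MappingSpace (triangleComplex d) X) (y) : restrict (inclusion d Sum.inl) X f y =
    f (SSet.toTop.map (inclusion d Sum.inl) y) := rfl
  refine mappingSpace_wedge_ext ?_ fun s t => ?_
  · rw [key, key, map_inclusion_basePoint, hb]
  · rw [key, key, map_inclusion_edgeLoop, he]

lemma restrict_inclusion_basePoint (f : MappingSpace (triangleComplex d) X) :
    restrict (inclusion d Sum.inl) X f (basePoint _) = f (basePoint d) :=
  congrArg f (map_inclusion_basePoint d Sum.inl)

lemma restrict_inclusion_edgeLoop (f : MappingSpace (triangleComplex d) X) (s : S) (t : I) :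
    restrict (inclusion d Sum.inl) X f (edgeLoop _ s t) = f (edgeLoop d (.inl s) t) :=
  congrArg f (map_inclusion_edgeLoop d Sum.inl s t)

/-- A loop of maps out of a wedge of circles with prescribed trace of the basepoint. -/
lemma exists_loop_wedge {f : MappingSpace (wedge S) X} {x : X} (hf : f (basePoint _) = x)
    (γ : S → Path x x) (hγ : ∀ s t, f (edgeLoop _ s t) = γ s t) (p : Path x x)
    (hp : ∀ s, (p.trans (γ s)).Homotopic ((γ s).trans p)) :
    ∃ Q : Path f f, ∀ t, Q t (basePoint _) = p t := by
  choose K hK0 hK1 hKb hKt using fun s => exists_square (hp s)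
  -- By the exponential law, a loop of maps on the wedge is a map from the wedge to `C(I, X)`: the
  -- vertex goes to `p`, and the circle `s` to the square filling the commutation relation.
  let δ (s : S) : Path p.toContinuousMap p.toContinuousMap :=
    { toContinuousMap := ((K s).comp ContinuousMap.prodSwap).curry
      source' := ContinuousMap.ext fun u => hKb s u
      target' := ContinuousMap.ext fun u => hKt s u }
  obtain ⟨g, hg, hg'⟩ := exists_extension (d := PEmpty.elim) δ (fun t => t.elim)
  let Q : C(I, MappingSpace (wedge S) X) := (g.uncurry.comp ContinuousMap.prodSwap).curry
  have hQ (u y) : Q u y = g y u := rfl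
  have hδ (s t u) : δ s t u = K s (u, t) := rfl
  refine ⟨⟨Q, mappingSpace_wedge_ext ?_ fun s t => ?_, mappingSpace_wedge_ext ?_ fun s t => ?_⟩,
    fun t => ?_⟩
  · rw [hf]
    exact (congrArg (· 0) hg).trans p.source
  · rw [hγ, ← hK0, ← hδ, ← hg']
    rfl
  · rw [hf]
    exact (congrArg (· 1) hg).trans p.target
  · rw [hγ, ← hK1, ← hδ, ← hg']
    rfl
  · exact congrArg (· t) hg

/-- The trace `p` of a path between the two extensions conjugates one solution into the other.
Lifting a loop with trace `p` from the wedge to the complex shows that `p` centralizes the first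
solution. -/
lemma homotopic_of_homotopic_inl
    (hf : IsWeakHomotopyEquiv (restrict (inclusion d Sum.inl) X)) {x : X}
    {γ γ' : S ⊕ N → Path x x}
    (hγ : ∀ t, ((γ (d t 2)).trans (γ (d t 0))).Homotopic (γ (d t 1)))
    (hγ' : ∀ t, ((γ' (d t 2)).trans (γ' (d t 0))).Homotopic (γ' (d t 1)))
    (h : ∀ s, γ (.inl s) = γ' (.inl s)) (e : S ⊕ N) : (γ e).Homotopic (γ' e) := by
  obtain ⟨f, hfb, hfe⟩ := exists_extension d γ hγ
  obtain ⟨f', hfb', hfe'⟩ := exists_extension d γ' hγ'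
  obtain ⟨P⟩ := exists_path_of_pi0Map_eq hf.1.1 (restrict_inclusion_ext (hfb.trans hfb'.symm)
    fun s t => by rw [hfe, hfe', h])
  let p : Path x x := ⟨⟨fun t => P t (basePoint d), by fun_prop⟩, by simp [hfb], by simp [hfb']⟩
  have hp (e) : (p.trans (γ' e)).Homotopic ((γ e).trans p) :=
    homotopic_of_tracePath P (edgeLoop d e) (fun _ => rfl) (fun _ => rfl)
      (fun t => (hfe e t).symm) (fun t => (hfe' e t).symm)
  -- On `S` the two families agree, so there `hp` is a commutation relation.
  obtain ⟨Q, hQ⟩ := exists_loop_wedge (f := restrict (inclusion d Sum.inl) X f)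
    ((restrict_inclusion_basePoint f).trans hfb) (fun s => γ (.inl s))
    (fun s t => (restrict_inclusion_edgeLoop f s t).trans (hfe _ t)) p
    (fun s => by have := hp (.inl s); rwa [← h] at this)
  obtain ⟨z, hz⟩ := exists_loop_of_homotopyGroupMap_surjective (hf.2 0 f).2 Q
  let q : Path x x := ⟨⟨fun t => z t (basePoint d), by fun_prop⟩, by simp [hfb], by simp [hfb]⟩
  have hq : (q.trans (γ e)).Homotopic ((γ e).trans q) :=
    homotopic_of_tracePath z (edgeLoop d e) (fun _ => rfl) (fun _ => rfl)
      (fun t => (hfe e t).symm) (fun t => (hfe e t).symm)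
  have hqp : q.Homotopic p := homotopic_map_of_eq hz
    ⟨fun f : MappingSpace (wedge S) X => f (basePoint _), continuous_eval_const _⟩
    (fun t => (restrict_inclusion_basePoint (z t)).symm) (fun t => (hQ t).symm)
  -- Conjugation by `p` sends `γ e` to `γ' e` by `hp`, and to `γ e` since `p` is homotopic to the
  -- trace `q` of a loop of maps on the whole complex.
  have h1 := FundamentalGroup.fundamentalGroupMulEquivOfPath_eq (hp e)
  have h2 := FundamentalGroup.fundamentalGroupMulEquivOfPath_eq
    (((hqp.symm.hcomp (.refl _)).trans hq).trans ((Path.Homotopic.refl (γ e)).hcomp hqp))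
  exact Path.Homotopic.Quotient.exact (h2.symm.trans h1)

/-- Equations between loops with bijective linearization have unique solutions in local spaces. -/
theorem IsHomologyLocal.existsUnique (hX : IsHomologyLocal R X)
    (hd : Function.Bijective (triangleBoundary R d)) (x : X) (s : S → FundamentalGroup X x) :
    ∃! c : N → FundamentalGroup X x, ∀ t,
      Sum.elim s c (d t 1) = Sum.elim s c (d t 0) * Sum.elim s c (d t 2) := by
  have hf := hX _ _ _ (isHomologyEquiv_inclusion R d hd)
  have hunique (c c' : S ⊕ N → FundamentalGroup X x) (hc : ∀ t, c (d t 1) = c (d t 0) * c (d t 2))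
      (hc' : ∀ t, c' (d t 1) = c' (d t 0) * c' (d t 2)) (h : ∀ i, c (.inl i) = c' (.inl i)) :
      c = c' := by
    choose γ hγ using fun e => Path.Homotopic.Quotient.mk_surjective (c e)
    choose γ' hγ' using fun e => Path.Homotopic.Quotient.mk_surjective (c' e)
    -- The representing loops on `S` must be equal, not merely homotopic, so that the two extensions
    -- restrict to the same map.
    let γ'' : S ⊕ N → Path x x := Sum.elim (γ ∘ .inl) (γ' ∘ .inr)
    have hγ'' (e) : Path.Homotopic.Quotient.mk (γ'' e) = c' e := by
      rcases e with i | e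
      · exact (hγ _).trans (h i)
      · exact hγ' _
    funext e
    rw [← hγ, ← hγ'']
    refine Path.Homotopic.Quotient.eq.2 (homotopic_of_homotopic_inl (γ := γ) (γ' := γ'') hf (fun t => ?_)
      (fun t => ?_) (fun _ => rfl) e) <;>
    rw [← Path.Homotopic.Quotient.eq, Path.Homotopic.Quotient.mk_trans]
    -- A product in the fundamental group runs through its right factor first, which matches side 2
    -- followed by side 0.
    · rw [hγ, hγ, hγ]
      exact (hc t).symm
    · rw [hγ'', hγ'', hγ'']
      exact (hc' t).symm
  obtain ⟨c, hc, hcs⟩ : ∃ c : S ⊕ N → FundamentalGroup X x,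
      (∀ t, c (d t 1) = c (d t 0) * c (d t 2)) ∧ ∀ i, c (.inl i) = s i := by
    choose γ hγ using fun i => Path.Homotopic.Quotient.mk_surjective (s i)
    obtain ⟨g, hgb, hge⟩ := exists_extension (d := PEmpty.elim) γ (fun t => t.elim)
    -- The restriction of `f` is only joined to `g` by a path; transport along its basepoint trace
    -- corrects this.
    obtain ⟨f, ⟨P⟩⟩ := exists_path_of_pi0Map_surjective hf.1.2 g
    let p : Path (f (basePoint d)) x := ⟨⟨fun t => P t (basePoint _), by fun_prop⟩,
      by simp [restrict_inclusion_basePoint], by simp [hgb]⟩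
    refine ⟨fun e => FundamentalGroup.fundamentalGroupMulEquivOfPath p
      (Path.Homotopic.Quotient.mk ((edgeLoop d e).map f.continuous)), fun t => ?_, fun i => ?_⟩
    · rw [← map_mul]
      refine congrArg _ (Path.Homotopic.Quotient.eq.2 ?_)
      have := (edgeLoop_homotopic d t).symm.map f
      rwa [Path.map_trans] at this
    · rw [← hγ]
      exact FundamentalGroup.fundamentalGroupMulEquivOfPath_eq (homotopic_of_tracePath P
        (edgeLoop _ i) (fun _ => rfl) (fun _ => rfl)
        (fun t => (restrict_inclusion_edgeLoop f i t).symm) (fun t => (hge i t).symm))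
  obtain rfl : s = c ∘ .inl := funext fun i => (hcs i).symm
  refine ⟨c ∘ .inr, ?_, fun c' hc' => ?_⟩
  · simpa only [Sum.elim_comp_inl_inr] using hc
  · exact congrArg (· ∘ Sum.inr) (hunique (Sum.elim (c ∘ .inl) c') c hc' hc fun _ => rfl)

end
end BousfieldHomology

/-! ### Encoding word equations by triangles -/

namespace BousfieldHomology
open FreeGroup TensorProduct

section words
variable {A : Type u} (w : A → List (A × Bool))

/-- The triangles that impose the equations `w a = a` between words in new generators and old
generators; the edges are the old generators, the new ones, and all words in the new ones. -/
def wordTriangle : List (A × Bool) ⊕ A → Fin 3 → A ⊕ (A ⊕ List (A × Bool))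
  | .inl [] => ![.inr (.inr []), .inr (.inr []), .inr (.inr [])]
  | .inl ((a, true) :: l) => ![.inr (.inl a), .inr (.inr ((a, true) :: l)), .inr (.inr l)]
  | .inl ((a, false) :: l) => ![.inr (.inl a), .inr (.inr l), .inr (.inr ((a, false) :: l))]
  | .inr a => ![.inl a, .inr (.inr (w a)), .inr (.inr [])]

/-- The triangles indexed by words determine the word edges recursively from the values on the
letters, so only the equations `w a = a` remain as conditions. -/
lemma wordTriangle_relations_iff {G : Type*} [Group G] (s : A → G)
    (c : A ⊕ List (A × Bool) → G) :
    (∀ t, Sum.elim s c (wordTriangle w t 1) =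
      Sum.elim s c (wordTriangle w t 0) * Sum.elim s c (wordTriangle w t 2)) ↔
    (∀ l, c (.inr l) = lift (fun a => c (.inl a)) (mk l)) ∧
      ∀ a, lift (fun a => c (.inl a)) (mk (w a)) = s a := by
  constructor
  · intro h
    have h1 : ∀ l, c (.inr l) = lift (fun a => c (.inl a)) (mk l) := by
      intro l
      induction l with
      -- The triangle with three equal sides gives `g = g * g`, hence `g = 1`.
      | nil => simpa [wordTriangle] using h (.inl [])
      | cons p l ih =>
        obtain ⟨a, _ | _⟩ := p
        · have := h (.inl ((a, false) :: l))
          simp_all [wordTriangle]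
        · have := h (.inl ((a, true) :: l))
          simp_all [wordTriangle]
    refine ⟨h1, fun a => ?_⟩
    have := h (.inr a)
    simp only [wordTriangle, Matrix.cons_val, Sum.elim_inl, Sum.elim_inr] at this
    rwa [h1, h1 [], ← one_eq_mk, _root_.map_one, mul_one] at this
  · rintro ⟨h1, h2⟩ ((_ | ⟨⟨a, _ | _⟩, l⟩) | a)
    · simp [wordTriangle, h1]
    · simp [wordTriangle, h1]
    · simp [wordTriangle, h1]
    · simp only [wordTriangle, Matrix.cons_val, Sum.elim_inl, Sum.elim_inr]
      rw [h1, h1 [], ← one_eq_mk, _root_.map_one, mul_one, h2]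

variable (R : Type*) [Ring R]

/-- The exponent sums of a word. -/
noncomputable def exponentSum : List (A × Bool) → A →₀ R
  | [] => 0
  | (a, true) :: l => exponentSum l + .single a 1
  | (a, false) :: l => exponentSum l - .single a 1

/-- A chain of triangles whose boundary compares a word with its exponent sums. -/
noncomputable def wordChain : List (A × Bool) → List (A × Bool) ⊕ A →₀ R
  | [] => .single (.inl []) 1
  | (a, true) :: l => wordChain l - .single (.inl ((a, true) :: l)) 1
  | (a, false) :: l => wordChain l + .single (.inl ((a, false) :: l)) 1

lemma triangleBoundary_single {S N T : Type u} (d : T → Fin 3 → S ⊕ N) (t : T) :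
    triangleBoundary R d (.single t 1) =
      edgeChain R (d t 0) - edgeChain R (d t 1) + edgeChain R (d t 2) := by
  simp [triangleBoundary]

lemma triangleBoundary_wordChain (l : List (A × Bool)) :
    triangleBoundary R (wordTriangle w) (wordChain R l) =
      .single (.inr l) 1 - Finsupp.lmapDomain R R Sum.inl (exponentSum R l) := by
  induction l with
  | nil => simp [wordChain, triangleBoundary_single, wordTriangle, edgeChain, exponentSum]
  | cons p l ih =>
    obtain ⟨a, _ | _⟩ := p <;>
    · simp only [wordChain, exponentSum, _root_.map_add, _root_.map_sub, ih, triangleBoundary_single]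
      simp [wordTriangle, edgeChain]
      abel

/-- Modulo boundaries, each word equals its exponent sums by `wordChain`, and each `w a` vanishes.
The exponent sums of the `w a` span, so the letters vanish, and then all words do. -/
lemma triangleBoundary_wordTriangle_surjective
    (h : Function.Surjective (Finsupp.linearCombination R fun a => exponentSum R (w a))) :
    Function.Surjective (triangleBoundary R (wordTriangle w)) := by
  set Φ := triangleBoundary R (wordTriangle w) with hΦ
  have hD (l) : (.single (.inr l) 1 - Finsupp.lmapDomain R R Sum.inl (exponentSum R l)) ∈
    LinearMap.range Φ := ⟨_, triangleBoundary_wordChain w R l⟩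
  have h0 : .single (.inr []) 1 ∈ LinearMap.range Φ := by
    simpa [exponentSum] using hD []
  have hw (a) : .single (.inr (w a)) 1 ∈ LinearMap.range Φ := by
    have := sub_mem h0 ⟨Finsupp.single (.inr a) 1, rfl⟩
    rw [hΦ, triangleBoundary_single] at this
    simpa [wordTriangle, edgeChain] using this
  have hx : (Finsupp.lmapDomain R R Sum.inl).range ≤ LinearMap.range Φ := by
    rintro _ ⟨v, rfl⟩
    obtain ⟨v, rfl⟩ := h v
    induction v using Finsupp.induction_linear with
    | zero => simp
    | add v v' hv hv' => rw [_root_.map_add, _root_.map_add]; exact add_mem hv hv'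
    | single a r =>
      rw [Finsupp.linearCombination_single, map_smul]
      refine Submodule.smul_mem _ _ ?_
      simpa using sub_mem (hw a) (hD (w a))
  refine LinearMap.range_eq_top.1 (eq_top_iff.2 fun v _ => ?_)
  induction v using Finsupp.induction_linear with
  | zero => exact zero_mem _
  | add v v' hv hv' => exact add_mem (hv trivial) (hv' trivial)
  | single e r =>
    rw [← mul_one r, ← smul_eq_mul, ← Finsupp.smul_single]
    refine Submodule.smul_mem _ _ ?_
    rcases e with a | l
    · exact hx ⟨.single a 1, by simp⟩
    · simpa using add_mem (hD l) (hx ⟨exponentSum R l, rfl⟩)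

/-- `P` replaces words by exponent sums and reduces the boundary to the exponent map on the equation
triangles, up to sign. Hence a cycle `v` has `π v = 0`. The contraction `D` inverts the boundary up
to a term factoring through `π`, so `v = 0`. -/
lemma triangleBoundary_wordTriangle_injective
    (h : Function.Injective (Finsupp.linearCombination R fun a => exponentSum R (w a))) :
    Function.Injective (triangleBoundary R (wordTriangle w)) := by
  set Φ := triangleBoundary R (wordTriangle w) with hΦ
  let π : (List (A × Bool) ⊕ A →₀ R) →ₗ[R] A →₀ R :=
    Finsupp.linearCombination R (Sum.elim 0 fun a => .single a 1)
  let P : (A ⊕ List (A × Bool) →₀ R) →ₗ[R] A →₀ R :=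
    Finsupp.linearCombination R (Sum.elim (fun a => .single a 1) (exponentSum R))
  let D : (A ⊕ List (A × Bool) →₀ R) →ₗ[R] List (A × Bool) ⊕ A →₀ R :=
    Finsupp.linearCombination R (Sum.elim 0 (wordChain R))
  let Ξ : (A →₀ R) →ₗ[R] List (A × Bool) ⊕ A →₀ R :=
    Finsupp.linearCombination R fun a =>
      .single (.inl []) 1 - wordChain R (w a) - .single (.inr a) 1
  have hP : P ∘ₗ Φ = -(Finsupp.linearCombination R fun a => exponentSum R (w a)) ∘ₗ π := by
    refine Finsupp.lhom_ext' fun t => LinearMap.ext_ring ?_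
    simp only [LinearMap.comp_apply, Finsupp.lsingle_apply, hΦ, triangleBoundary_single]
    obtain (_ | ⟨⟨a, _ | _⟩, l⟩) | a := t <;>
      simp [wordTriangle, edgeChain, P, π, exponentSum]
  have hD : D ∘ₗ Φ = LinearMap.id + Ξ ∘ₗ π := by
    refine Finsupp.lhom_ext' fun t => LinearMap.ext_ring ?_
    simp only [LinearMap.comp_apply, Finsupp.lsingle_apply, hΦ, triangleBoundary_single]
    obtain (_ | ⟨⟨a, _ | _⟩, l⟩) | a := t <;>
      simp [wordTriangle, edgeChain, D, π, Ξ, wordChain]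
    abel
  refine (injective_iff_map_eq_zero Φ).2 fun v hv => ?_
  have h1 : π v = 0 := h (by simpa [hv] using (LinearMap.congr_fun hP v).symm)
  simpa [hv, h1] using (LinearMap.congr_fun hD v).symm

end words

/-! ### Abelianization and the exponent matrix -/

section freeGroup
variable {ι A : Type*} [DecidableEq ι] (R : Type*) [Ring R] (ρ : ι ≃ A)

/-- The free module on the generators as a tensor product with the abelianized free group. -/
noncomputable def tensorAbelianizationEquiv :
    R ⊗[ℤ] Additive (Abelianization (FreeGroup ι)) ≃ₗ[ℤ] (A →₀ R) :=
  (TensorProduct.congr (.refl ℤ R)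
    -- `FreeAbelianGroup ι` is by definition the additive abelianization of `FreeGroup ι`.
    (FreeAbelianGroup.equivFinsupp ι).toIntLinearEquiv).trans
    ((TensorProduct.finsuppScalarRight ℤ ℤ R ι).trans
      (Finsupp.domLCongr ρ))

lemma tensorAbelianizationEquiv_tmul_of (r : R) (i : ι) :
    tensorAbelianizationEquiv R ρ (r ⊗ₜ .ofMul (Abelianization.of (of i))) =
      .single (ρ i) r := by
  have : FreeAbelianGroup.equivFinsupp ι (.ofMul (Abelianization.of (of i))) = .single i 1 :=
    FreeAbelianGroup.toFinsupp_of i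
  change Finsupp.domLCongr (R := ℤ) ρ (TensorProduct.finsuppScalarRight ℤ ℤ R ι
    (r ⊗ₜ FreeAbelianGroup.equivFinsupp ι (.ofMul (Abelianization.of (of i))))) = _
  rw [this]
  have h : TensorProduct.finsuppScalarRight ℤ ℤ R ι (r ⊗ₜ .single i 1) = .single i r := by
    ext j
    simp [TensorProduct.finsuppScalarRight_apply_tmul_apply, Finsupp.single_apply]
  rw [h]
  simp

lemma tensorAbelianizationEquiv_tmul_mk (r : R) (l : List (ι × Bool)) :
    tensorAbelianizationEquiv R ρ (r ⊗ₜ .ofMul (Abelianization.of (mk l))) =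
      r • exponentSum R (l.map (Prod.map ρ id)) := by
  induction l with
  | nil => simp [← one_eq_mk, exponentSum]
  | cons p l ih =>
    obtain ⟨i, _ | _⟩ := p
    · have : mk ((i, false) :: l) = (of i)⁻¹ * mk l := rfl
      rw [this, _root_.map_mul, ofMul_mul, tmul_add, _root_.map_add, ih, _root_.map_inv,
        ofMul_inv, tmul_neg, _root_.map_neg, tensorAbelianizationEquiv_tmul_of]
      simp [exponentSum, smul_sub]
      abel
    · have : mk ((i, true) :: l) = of i * mk l := rfl
      rw [this, _root_.map_mul, ofMul_mul, tmul_add, _root_.map_add, ih, tensorAbelianizationEquiv_tmul_of]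
      simp [exponentSum, smul_add]
      abel

end freeGroup

section
variable {n : ℕ} {A : Type u} {R : Type*} [Ring R] (ρ : Fin n ≃ A)
  (α : FreeGroup (Fin n) →* FreeGroup (Fin n))

/-- The words that represent the images of the generators. -/
def imageWord (a : A) : List (A × Bool) :=
  (α (of (ρ.symm a))).toWord.map (Prod.map ρ id)

lemma linearCombination_imageWord_bijective (hα : Function.Bijective ((abMap α).lTensor R)) :
    Function.Bijective
      (Finsupp.linearCombination R fun a => exponentSum R (imageWord ρ α a)) := by
  let e := tensorAbelianizationEquiv R ρ
  -- This is an equality of functions: the left side is `R`-linear, while the right side is built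
  -- from `ℤ`-linear maps.
  have key : (Finsupp.linearCombination R fun a => exponentSum R (imageWord ρ α a)) =
      e ∘ (abMap α).lTensor R ∘ e.symm := by
    funext v
    obtain ⟨v, rfl⟩ := e.surjective v
    rw [Function.comp_apply, Function.comp_apply, LinearEquiv.symm_apply_apply]
    induction v using TensorProduct.induction_on with
    | zero => simp
    | add v v' hv hv' => simp only [_root_.map_add, hv, hv']
    | tmul r g =>
      obtain ⟨g, rfl⟩ := Additive.ofMul.surjective g
      obtain ⟨g, rfl⟩ := QuotientGroup.mk_surjective g
      change _ = e (r ⊗ₜ .ofMul (Abelianization.of (α g)))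
      change Finsupp.linearCombination R _ (e (r ⊗ₜ .ofMul (Abelianization.of g))) = _
      induction g using FreeGroup.induction_on with
      | C1 => simp
      | of i =>
        rw [tensorAbelianizationEquiv_tmul_of, Finsupp.linearCombination_single, imageWord,
          Equiv.symm_apply_apply, ← tensorAbelianizationEquiv_tmul_mk, mk_toWord]
      | inv_of i h =>
        simp only [_root_.map_inv, ofMul_inv, tmul_neg, _root_.map_neg, h]
      | mul g g' h h' =>
        simp only [_root_.map_mul, ofMul_mul, tmul_add, _root_.map_add, h, h']
  rw [key]
  exact e.bijective.comp (hα.comp e.symm.bijective)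

/-- A solution amounts to its values on the letters, and the remaining equations say that `pullback
α G` sends this tuple to `s`. -/
lemma pullback_bijective_iff {G : Type*} [Group G] :
    Function.Bijective (pullback α G) ↔ ∀ s : A → G, ∃! c : A ⊕ List (A × Bool) → G, ∀ t,
      Sum.elim s c (wordTriangle (imageWord ρ α) t 1) =
        Sum.elim s c (wordTriangle (imageWord ρ α) t 0) *
          Sum.elim s c (wordTriangle (imageWord ρ α) t 2) := by
  have hlift (x : A → G) (l : List (Fin n × Bool)) :
      lift x (mk (l.map (Prod.map ρ id))) = lift (fun i => x (ρ i)) (mk l) := by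
    rw [FreeGroup.lift_mk, FreeGroup.lift_mk, List.map_map]
    rfl
  have key (x : A → G) (s : A → G) : (∀ a, lift x (mk (imageWord ρ α a)) = s a) ↔
      pullback α G (x ∘ ρ) = s ∘ ρ := by
    rw [funext_iff, ρ.forall_congr_left]
    refine forall_congr' fun a => ?_
    rw [imageWord, hlift, mk_toWord, Function.comp_apply, Equiv.apply_symm_apply]
    rfl
  simp_rw [wordTriangle_relations_iff, key, Function.bijective_iff_existsUnique]
  constructor
  · intro h s
    obtain ⟨x, hx, hx'⟩ := h (s ∘ ρ)
    refine ⟨Sum.elim (x ∘ ρ.symm) fun l => lift (x ∘ ρ.symm) (mk l), ⟨fun l => rfl, ?_⟩, ?_⟩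
    · simpa [Function.comp_def] using hx
    · rintro c ⟨hc, hc'⟩
      have h1 : (fun a => c (.inl a)) = x ∘ ρ.symm := by
        rw [← hx' _ hc']
        simp [Function.comp_def]
      funext e
      rcases e with a | l
      · exact congrFun h1 a
      · rw [hc, h1]
        rfl
  · intro h s
    obtain ⟨c, ⟨hc, hc'⟩, hu⟩ := h (s ∘ ρ.symm)
    refine ⟨fun i => c (.inl (ρ i)), ?_, fun x hx => ?_⟩
    · simpa [Function.comp_def] using hc'
    · have := hu (Sum.elim (x ∘ ρ.symm) fun l => lift (x ∘ ρ.symm) (mk l))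
        ⟨fun l => rfl, by simpa [Function.comp_def] using hx⟩
      simp [← this]

end
end BousfieldHomology


theorem mainTheorem12 (n : ℕ) (α : FreeGroup (Fin n) →* FreeGroup (Fin n))
    (R : Type v) [Ring R]
    (hα : Function.Bijective ((BousfieldHomology.abMap α).lTensor R))
    (X : Type u) [TopologicalSpace X] (hX : BousfieldHomology.IsHomologyLocal R X) (x : X) :
    Function.Bijective (BousfieldHomology.pullback α (FundamentalGroup X x)) := by
  -- `ULift` moves the generators to the universe of `X`, where the simplicial sets live.
  have h := BousfieldHomology.linearCombination_imageWord_bijective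
    (Equiv.ulift.{u, 0} (α := Fin n)).symm α hα
  refine (BousfieldHomology.pullback_bijective_iff Equiv.ulift.symm α).2 fun s =>
    hX.existsUnique ⟨?_, ?_⟩ x s
  · exact BousfieldHomology.triangleBoundary_wordTriangle_injective _ R h.1
  · exact BousfieldHomology.triangleBoundary_wordTriangle_surjective _ R h.2
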